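/- Let $N\ge 2$ be an integer, $\lambda>1$, and let $X=\{1,\dots,N\}^{\mathbb N}$ be the full $N$-shift with the ultrametric $d(x,y)=\lambda^{-\inf\{k-1\,:\,x_k\ne y_k\}}$ (and $d(x,x)=0$) and the Bernoulli measure $\mu$, given on cylinder sets $C_w=\{x : x_1\cdots x_{|w|}=w\}$ by $\mu(C_w)=N^{-|w|}$. Put $\delta=\log N/\log\lambda$. Let $\Delta$ be the logarithmic Dirichlet Laplacian of $(X,d,\mu)$, that is, the positive self-adjoint operator on the real Hilbert space $L^2(X,\mu)$ associated to the form $$\mathcal E(f,g)=\frac12\int_X\int_X\frac{(f(x)-f(y))(g(x)-g(y))}{d(x,y)^{\delta}}\,d\mu(y)\,d\mu(x)$$ whose domain $\operatorname{Dom}\mathcal E$ consists of all $f\in L^2(X,\mu)$ with $\int_X\int_X |f(x)-f(y)|^2 d(x,y)^{-\delta}\,d\mu(y)\,d\mu(x)<\infty$; thus $f\in\operatorname{Dom}\Delta$ and $\Delta f=h$ if and only if $f\in\operatorname{Dom}\mathcal E$, $h\in L^2(X,\mu)$ and $\mathcal E(f,g)=\langle h,g\rangle$ for all $g\in\operatorname{Dom}\mathcal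 E$. For $n\ge 0$ let $V_n$ be the span of the characteristic functions of the cylinder sets $C_w$ with $|w|=n$ (where $C_\emptyset=X$), let $P_n$ be the orthogonal projection of $L^2(X,\mu)$ onto $V_n$, and let $Q_n=P_{n+1}-P_n$. Then the $Q_n$ yield a spectral decomposition of $\Delta$: the $Q_n$ are mutually orthogonal orthogonal projections of rank $N^n(N-1)$, $P_0+\sum_{n\ge 0}Q_n=1$ strongly, $\Delta$ vanishes on $\operatorname{Im}P_0$ and is multiplication by $$\theta_n=1+\Bigl(1-\frac1N\Bigr)n$$ on $\operatorname{Im}Q_n\subset\operatorname{Dom}\Delta$, a function $f\in L^2(X,\mu)$ lies in $\operatorname{Dom}\Delta$ if and only if $\sum_{n\ge0}\theta_n^2\|Q_nf\|^2<\infty$, and in that case $\Delta f=\sum_{n\ge 0}\theta_n Q_nf$. Consequently the Lipschitz functions on $(X,d)$ are contained in $\operatorname{Dom}\Delta$ and form a core for $\Delta$. Moreover, there is a unique strongly continuous semigroup $(e^{-t\Delta})_{t\ge0}$ with generator $-\Delta$ and, for every $t>0$, the operator $e^{-t\Delta}$ is compact, and it is trace class if and only if $$t>\frac{N\log N}{N-1}.$$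 -/

import Mathlib

open MeasureTheory Filter Topology
open scoped NNReal InnerProductSpace

/-! ### Forms, operators and semigroups on a real Hilbert space -/

section Hilbert

universe u

variable {H : Type u} [NormedAddCommGroup H] [InnerProductSpace ℝ H]

/-- The graph of the operator associated to a bilinear form `Q` with domain `D ⊆ H`: the pairs
`(f, h)` with `f ∈ D` and `Q(f, g) = ⟨h, g⟩` for all `g ∈ D`. With `R` the operator determined by
`⟨R k, g⟩ + Q(R k, g) = ⟨k, g⟩` for `g ∈ D`, this is `{(R k, k - R k) | k ∈ H}`. -/
def formGraph (D : Submodule ℝ H) (Q : D →ₗ[ℝ] D →ₗ[ℝ] ℝ) : Submodule ℝ (H × H) where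
  carrier := {p | ∃ hp : p.1 ∈ D, ∀ g : D, Q ⟨p.1, hp⟩ g = ⟪p.2, (g : H)⟫_ℝ}
  zero_mem' := by
    refine ⟨D.zero_mem, fun g => ?_⟩
    have h0 : (⟨(0 : H × H).1, D.zero_mem⟩ : D) = 0 := rfl
    rw [h0]; simp
  add_mem' := by
    rintro p q ⟨hp, hp'⟩ ⟨hq, hq'⟩
    refine ⟨D.add_mem hp hq, fun g => ?_⟩
    have h0 : (⟨(p + q).1, D.add_mem hp hq⟩ : D) = ⟨p.1, hp⟩ + ⟨q.1, hq⟩ := rfl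
    rw [h0, map_add, LinearMap.add_apply, hp', hq', ← inner_add_left]; rfl
  smul_mem' := by
    rintro c p ⟨hp, hp'⟩
    refine ⟨D.smul_mem c hp, fun g => ?_⟩
    have h0 : (⟨(c • p).1, D.smul_mem c hp⟩ : D) = c • ⟨p.1, hp⟩ := rfl
    rw [h0, map_smul, LinearMap.smul_apply, hp', smul_eq_mul, ← real_inner_smul_left]; rfl

/-- The (unbounded) operator associated to a densely defined bilinear form. -/
noncomputable def formOperator (D : Submodule ℝ H) (Q : D →ₗ[ℝ] D →ₗ[ℝ] ℝ) : H →ₗ.[ℝ] H :=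
  (formGraph D Q).toLinearPMap

/-- `T` is the strongly continuous one-parameter semigroup `t ↦ e^{-tA}`, i.e. its infinitesimal
generator is exactly `-A` (including the domain). -/
structure IsHeatSemigroup (A : H →ₗ.[ℝ] H) (T : ℝ≥0 → H →L[ℝ] H) : Prop where
  map_zero : T 0 = ContinuousLinearMap.id ℝ H
  map_add : ∀ s t, T (s + t) = T s ∘L T t
  continuous : ∀ f, Continuous fun t => T t f
  generator : ∀ f h : H, (f, h) ∈ A.graph ↔
    Tendsto (fun t : ℝ≥0 => (t : ℝ)⁻¹ • (f - T t f)) (𝓝[>] 0) (𝓝 h)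

/-- `T` is trace class: `|T|`, the positive operator `S` with `S² = T* T`, has finite trace. -/
def IsTraceClass [CompleteSpace H] (T : H →L[ℝ] H) : Prop :=
  ∃ S : H →L[ℝ] H, S.IsPositive ∧ S ∘L S = ContinuousLinearMap.adjoint T ∘L T ∧
    ∀ (ι : Type u) (b : HilbertBasis ι ℝ H), Summable fun i => ⟪S (b i), b i⟫_ℝ

end Hilbert

/-! ### The logarithmic Dirichlet Laplacian of a metric-measure space -/

section LogLaplacian

set_option linter.unusedSectionVars false

variable {X : Type*} [MetricSpace X] [SecondCountableTopology X] [MeasurableSpace X] [BorelSpace X]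

theorem logForm_aestronglyMeasurable_sub (μ : Measure X) [IsFiniteMeasure μ] (f : Lp ℝ 2 μ) :
    AEStronglyMeasurable (fun p : X × X => f p.1 - f p.2) (μ.prod μ) :=
  (((Lp.stronglyMeasurable f).comp_measurable measurable_fst).sub
    ((Lp.stronglyMeasurable f).comp_measurable measurable_snd)).aestronglyMeasurable

theorem logForm_coeFn_add (μ : Measure X) [IsFiniteMeasure μ] (f g : Lp ℝ 2 μ) :
    ∀ᵐ p ∂(μ.prod μ), (f + g : Lp ℝ 2 μ) p.1 - (f + g : Lp ℝ 2 μ) p.2 =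
      (f p.1 - f p.2) + (g p.1 - g p.2) := by
  have h := Lp.coeFn_add f g
  filter_upwards [Measure.quasiMeasurePreserving_fst.ae h,
    Measure.quasiMeasurePreserving_snd.ae h] with p h1 h2
  rw [h1, h2]; simp only [Pi.add_apply]; ring

theorem logForm_coeFn_smul (μ : Measure X) [IsFiniteMeasure μ] (c : ℝ) (f : Lp ℝ 2 μ) :
    ∀ᵐ p ∂(μ.prod μ), (c • f : Lp ℝ 2 μ) p.1 - (c • f : Lp ℝ 2 μ) p.2 =
      c * (f p.1 - f p.2) := by
  have h := Lp.coeFn_smul c f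
  filter_upwards [Measure.quasiMeasurePreserving_fst.ae h,
    Measure.quasiMeasurePreserving_snd.ae h] with p h1 h2
  rw [h1, h2]; simp only [Pi.smul_apply, smul_eq_mul]; ring

theorem logForm_integrable_mul (μ : Measure X) [IsFiniteMeasure μ] (δ : ℝ) (f g : Lp ℝ 2 μ)
    (hf : Integrable (fun p : X × X => (f p.1 - f p.2) ^ 2 / dist p.1 p.2 ^ δ) (μ.prod μ))
    (hg : Integrable (fun p : X × X => (g p.1 - g p.2) ^ 2 / dist p.1 p.2 ^ δ) (μ.prod μ)) :
    Integrable (fun p : X × X => (f p.1 - f p.2) * (g p.1 - g p.2) / dist p.1 p.2 ^ δ)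
      (μ.prod μ) := by
  have hd : AEStronglyMeasurable (fun p : X × X => (dist p.1 p.2 ^ δ)⁻¹) (μ.prod μ) :=
    ((measurable_dist.pow_const δ).inv).aestronglyMeasurable
  refine (hf.add hg).mono' ?_ (Eventually.of_forall fun p => ?_)
  · exact ((logForm_aestronglyMeasurable_sub μ f).mul
      (logForm_aestronglyMeasurable_sub μ g)).mul hd
  · have h0 : 0 ≤ dist p.1 p.2 ^ δ := Real.rpow_nonneg dist_nonneg δ
    rw [Real.norm_eq_abs, abs_div, abs_of_nonneg h0, Pi.add_apply, ← add_div]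
    gcongr
    rw [abs_mul]
    nlinarith [sq_nonneg (|f p.1 - f p.2| - |g p.1 - g p.2|), sq_abs (f p.1 - f p.2),
      sq_abs (g p.1 - g p.2), abs_nonneg (f p.1 - f p.2), abs_nonneg (g p.1 - g p.2)]

/-- The form domain `{f ∈ L²(X, μ) | ∬ |f(x) - f(y)|² / d(x,y)^δ dμ(y) dμ(x) < ∞}`. (On the diagonal
the integrand has the value `0`.) -/
def logFormDomain (μ : Measure X) [IsFiniteMeasure μ] (δ : ℝ) : Submodule ℝ (Lp ℝ 2 μ) where
  carrier := {f | Integrable (fun p : X × X => (f p.1 - f p.2) ^ 2 / dist p.1 p.2 ^ δ) (μ.prod μ)}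
  zero_mem' := by
    have h := logForm_coeFn_smul μ 0 (0 : Lp ℝ 2 μ)
    rw [zero_smul] at h
    refine (integrable_zero (X × X) ℝ (μ.prod μ)).congr ?_
    filter_upwards [h] with p hp
    rw [hp, zero_mul]; simp
  add_mem' := by
    intro f g hf hg
    refine ((hf.add hg).add ((logForm_integrable_mul μ δ f g hf hg).const_mul 2)).congr ?_
    filter_upwards [logForm_coeFn_add μ f g] with p hp
    rw [hp]; simp only [Pi.add_apply]; ring
  smul_mem' := by
    intro c f hf
    refine (hf.const_mul (c ^ 2)).congr ?_
    filter_upwards [logForm_coeFn_smul μ c f] with p hp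
    rw [hp]; ring

/-- The form
`ℰ(f, g) = ½ ∬ (f(x) - f(y)) (g(x) - g(y)) / d(x,y)^δ dμ(y) dμ(x)` on its domain. -/
noncomputable def logForm (μ : Measure X) [IsFiniteMeasure μ] (δ : ℝ) :
    logFormDomain μ δ →ₗ[ℝ] logFormDomain μ δ →ₗ[ℝ] ℝ :=
  LinearMap.mk₂ ℝ
    (fun f g : logFormDomain μ δ => (1 / 2 : ℝ) * ∫ p : X × X, ((f : Lp ℝ 2 μ) p.1 - (f : Lp ℝ 2 μ) p.2) *
      ((g : Lp ℝ 2 μ) p.1 - (g : Lp ℝ 2 μ) p.2) / dist p.1 p.2 ^ δ ∂(μ.prod μ))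
    (by
      intro f f' g
      rw [← mul_add, ← integral_add (logForm_integrable_mul μ δ f g f.2 g.2)
        (logForm_integrable_mul μ δ f' g f'.2 g.2)]
      congr 1
      refine integral_congr_ae ?_
      filter_upwards [logForm_coeFn_add μ (f : Lp ℝ 2 μ) f'] with p hp
      rw [Submodule.coe_add, hp]; ring)
    (by
      intro c f g
      rw [smul_eq_mul, mul_left_comm, ← integral_const_mul c]
      congr 1
      refine integral_congr_ae ?_
      filter_upwards [logForm_coeFn_smul μ c (f : Lp ℝ 2 μ)] with p hp
      rw [Submodule.coe_smul, hp]; ring)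
    (by
      intro f g g'
      rw [← mul_add, ← integral_add (logForm_integrable_mul μ δ f g f.2 g.2)
        (logForm_integrable_mul μ δ f g' f.2 g'.2)]
      congr 1
      refine integral_congr_ae ?_
      filter_upwards [logForm_coeFn_add μ (g : Lp ℝ 2 μ) g'] with p hp
      rw [Submodule.coe_add, hp]; ring)
    (by
      intro c f g
      rw [smul_eq_mul, mul_left_comm, ← integral_const_mul c]
      congr 1
      refine integral_congr_ae ?_
      filter_upwards [logForm_coeFn_smul μ c (g : Lp ℝ 2 μ)] with p hp
      rw [Submodule.coe_smul, hp]; ring)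

/-- The logarithmic Dirichlet Laplacian of a metric-measure space `(X, d, μ)` of dimension `δ`. -/
noncomputable def logDirichletLaplacian (μ : Measure X) [IsFiniteMeasure μ] (δ : ℝ) :
    Lp ℝ 2 μ →ₗ.[ℝ] Lp ℝ 2 μ :=
  formOperator (logFormDomain μ δ) (logForm μ δ)

end LogLaplacian

/-- The (classes of) Lipschitz functions in `L²(X, μ)`. -/
def lipschitzL2 {X : Type*} [MetricSpace X] [MeasurableSpace X] (μ : Measure X) :
    Submodule ℝ (Lp ℝ 2 μ) where
  carrier := {f | ∃ (g : X → ℝ) (K : ℝ≥0), LipschitzWith K g ∧ f =ᵐ[μ] g}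
  zero_mem' := ⟨fun _ => 0, 0, LipschitzWith.const 0, Lp.coeFn_zero ℝ 2 μ⟩
  add_mem' := by
    rintro f f' ⟨g, K, hg, hfg⟩ ⟨g', K', hg', hfg'⟩
    exact ⟨g + g', K + K', hg.add hg', (Lp.coeFn_add f f').trans (hfg.add hfg')⟩
  smul_mem' := by
    rintro c f ⟨g, K, hg, hfg⟩
    refine ⟨c • g, ‖c‖₊ * K, (lipschitzWith_smul c).comp hg, ?_⟩
    filter_upwards [Lp.coeFn_smul c f, hfg] with x h1 h2
    rw [h1, Pi.smul_apply, Pi.smul_apply, h2]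

/-! ### The full shift -/

/-- The space of infinite words over an alphabet of `N` letters (positions start at `0`), to be
equipped with the ultrametric of parameter `lam`. -/
def FullShift (N : ℕ) (_lam : ℝ) : Type := ℕ → Fin N

namespace FullShift

variable {N : ℕ} {lam : ℝ}

/-- `d(x, y) = lam ^ (-k)` with `k` the first position (counted from `0`) at which `x` and `y`
differ, and `d(x, x) = 0`. -/
noncomputable def shiftDist (x y : FullShift N lam) : ℝ :=
  open Classical in if x = y then 0 else (lam ^ PiNat.firstDiff (E := fun _ => Fin N) x y)⁻¹

theorem shiftDist_comm (x y : FullShift N lam) : shiftDist x y = shiftDist y x := by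
  unfold shiftDist
  rw [PiNat.firstDiff_comm (E := fun _ => Fin N) x y]
  classical
  exact if_congr eq_comm rfl rfl

theorem shiftDist_nonneg (hlam : 1 < lam) (x y : FullShift N lam) : 0 ≤ shiftDist x y := by
  unfold shiftDist
  split_ifs
  · exact le_rfl
  · positivity

theorem shiftDist_le_max (hlam : 1 < lam) (x y z : FullShift N lam) :
    shiftDist x z ≤ max (shiftDist x y) (shiftDist y z) := by
  by_cases hxz : x = z
  · have h0 : shiftDist x z = 0 := if_pos hxz
    rw [h0]
    exact le_max_of_le_left (shiftDist_nonneg hlam _ _)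
  by_cases hxy : x = y
  · rw [hxy]; exact le_max_right _ _
  by_cases hyz : y = z
  · rw [hyz]; exact le_max_left _ _
  have h := PiNat.min_firstDiff_le (E := fun _ => Fin N) x y z hxz
  simp only [shiftDist, if_neg hxz, if_neg hxy, if_neg hyz]
  rcases min_le_iff.1 h with h | h
  · refine le_max_of_le_left ?_
    gcongr
    exact hlam.le
  · refine le_max_of_le_right ?_
    gcongr
    exact hlam.le

theorem eq_of_shiftDist_eq_zero (hlam : 1 < lam) (x y : FullShift N lam)
    (h : shiftDist x y = 0) : x = y := by
  by_contra hxy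
  simp only [shiftDist, if_neg hxy] at h
  have : 0 < (lam ^ PiNat.firstDiff (E := fun _ => Fin N) x y)⁻¹ := by positivity
  exact this.ne' h

theorem shiftDist_le_of_mem_cylinder (hlam : 1 < lam) (x y : FullShift N lam) (n : ℕ)
    (h : x ∈ PiNat.cylinder (E := fun _ => Fin N) y n) : shiftDist x y ≤ (lam ^ n)⁻¹ := by
  by_cases hxy : x = y
  · have h0 : shiftDist x y = 0 := if_pos hxy
    rw [h0]; positivity
  · simp only [shiftDist, if_neg hxy]
    have := (PiNat.mem_cylinder_iff_le_firstDiff (E := fun _ => Fin N) hxy n).1 h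
    gcongr
    exact hlam.le

theorem mem_cylinder_of_shiftDist_lt (hlam : 1 < lam) (x y : FullShift N lam) (n : ℕ)
    (h : shiftDist x y < (lam ^ n)⁻¹) : x ∈ PiNat.cylinder (E := fun _ => Fin N) y n := by
  by_cases hxy : x = y
  · rw [hxy]; exact PiNat.self_mem_cylinder _ _
  · simp only [shiftDist, if_neg hxy] at h
    refine (PiNat.mem_cylinder_iff_le_firstDiff (E := fun _ => Fin N) hxy n).2 ?_
    have h2 : lam ^ n < lam ^ PiNat.firstDiff (E := fun _ => Fin N) x y :=
      (inv_lt_inv₀ (by positivity) (by positivity)).1 h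
    exact ((pow_lt_pow_iff_right₀ hlam).1 h2).le

theorem isOpen_iff_shiftDist (hlam : 1 < lam) (s : Set (ℕ → Fin N)) :
    IsOpen s ↔ ∀ x ∈ s, ∃ ε > 0, ∀ y, shiftDist (lam := lam) x y < ε → y ∈ s := by
  constructor
  · intro hs x hx
    obtain ⟨v, ⟨y, n, rfl⟩, h'x, h's⟩ :=
      (PiNat.isTopologicalBasis_cylinders (fun _ => Fin N)).exists_subset_of_mem_open hx hs
    rw [← PiNat.mem_cylinder_iff_eq.1 h'x] at h's
    refine ⟨(lam ^ n)⁻¹, by positivity, fun y hy => h's ?_⟩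
    exact mem_cylinder_of_shiftDist_lt hlam y x n ((shiftDist_comm y x).trans_lt hy)
  · intro h
    refine (PiNat.isTopologicalBasis_cylinders (fun _ => Fin N)).isOpen_iff.2 fun x hx => ?_
    rcases h x hx with ⟨ε, εpos, hε⟩
    obtain ⟨n, hn⟩ : ∃ n : ℕ, (lam⁻¹) ^ n < ε :=
      exists_pow_lt_of_lt_one εpos (inv_lt_one_of_one_lt₀ hlam)
    refine ⟨PiNat.cylinder x n, ⟨x, n, rfl⟩, PiNat.self_mem_cylinder x n, fun y hy => hε y ?_⟩
    rw [inv_pow] at hn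
    exact (shiftDist_comm (lam := lam) x y).trans_lt
      ((shiftDist_le_of_mem_cylinder hlam y x n hy).trans_lt hn)

/-- The ultrametric; its topology is the product topology. -/
noncomputable instance [hlam : Fact (1 < lam)] : MetricSpace (FullShift N lam) :=
  letI : TopologicalSpace (FullShift N lam) :=
    inferInstanceAs (TopologicalSpace (ℕ → Fin N))
  MetricSpace.ofDistTopology shiftDist (fun _ => if_pos rfl) shiftDist_comm
    (fun x y z => (shiftDist_le_max hlam.out x y z).trans
      (max_le_add_of_nonneg (shiftDist_nonneg hlam.out x y) (shiftDist_nonneg hlam.out y z)))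
    (isOpen_iff_shiftDist hlam.out) (eq_of_shiftDist_eq_zero hlam.out)

instance : MeasurableSpace (FullShift N lam) :=
  inferInstanceAs (MeasurableSpace (ℕ → Fin N))

instance [Fact (1 < lam)] : SecondCountableTopology (FullShift N lam) :=
  inferInstanceAs (SecondCountableTopology (ℕ → Fin N))

instance [Fact (1 < lam)] : BorelSpace (FullShift N lam) :=
  inferInstanceAs (BorelSpace (ℕ → Fin N))

/-- The Bernoulli measure: the infinite product of the uniform probability measures on the
alphabet, so that a cylinder of a word of length `n` has measure `N ^ (-n)`. -/
noncomputable def bernoulliMeasure (N : ℕ) (lam : ℝ) : Measure (FullShift N lam) :=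
  Measure.infinitePi (fun _ : ℕ => ProbabilityTheory.uniformOn (Set.univ : Set (Fin N)))

instance [N.AtLeastTwo] : IsProbabilityMeasure (bernoulliMeasure N lam) :=
  inferInstanceAs (IsProbabilityMeasure
    (Measure.infinitePi (fun _ : ℕ => ProbabilityTheory.uniformOn (Set.univ : Set (Fin N)))))

/-- The cylinder set of a finite word `w` of length `n`. -/
def cyl {n : ℕ} (w : Fin n → Fin N) : Set (FullShift N lam) :=
  {x | ∀ k : Fin n, x k = w k}

theorem measurableSet_cyl {n : ℕ} (w : Fin n → Fin N) :
    MeasurableSet (cyl w : Set (FullShift N lam)) := by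
  have h : (cyl w : Set (FullShift N lam)) = ⋂ k : Fin n, (fun x : ℕ → Fin N => x k) ⁻¹' {w k} := by
    exact Set.ext fun x => ⟨fun h => Set.mem_iInter.2 fun k => h k, fun h k => Set.mem_iInter.1 h k⟩
  rw [h]
  exact MeasurableSet.iInter fun k => measurable_pi_apply (k : ℕ) (measurableSet_singleton _)

variable (N lam) [N.AtLeastTwo]

/-- `V_n`: the span of the characteristic functions of the cylinder sets of words of length `n`. -/
noncomputable def V (n : ℕ) : Submodule ℝ (Lp ℝ 2 (bernoulliMeasure N lam)) :=
  Submodule.span ℝ (Set.range fun w : Fin n → Fin N =>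
    indicatorConstLp 2 (measurableSet_cyl w) (measure_ne_top (bernoulliMeasure N lam) _) (1 : ℝ))

instance (n : ℕ) : FiniteDimensional ℝ (V N lam n) :=
  FiniteDimensional.span_of_finite ℝ (Set.finite_range _)

/-- `P_n`: the orthogonal projection of `L²(X, μ)` onto `V_n`. -/
noncomputable def P (n : ℕ) : Lp ℝ 2 (bernoulliMeasure N lam) →L[ℝ] Lp ℝ 2 (bernoulliMeasure N lam) :=
  (V N lam n).starProjection

/-- `Q_n = P_{n+1} - P_n`. -/
noncomputable def Q (n : ℕ) : Lp ℝ 2 (bernoulliMeasure N lam) →L[ℝ] Lp ℝ 2 (bernoulliMeasure N lam) :=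
  P N lam (n + 1) - P N lam n

/-- The logarithmic Dirichlet Laplacian of the full shift, of dimension `δ = log N / log lam`. -/
noncomputable def Laplacian [Fact (1 < lam)] :
    Lp ℝ 2 (bernoulliMeasure N lam) →ₗ.[ℝ] Lp ℝ 2 (bernoulliMeasure N lam) :=
  logDirichletLaplacian (bernoulliMeasure N lam) (Real.log N / Real.log lam)

end FullShift

/-- The eigenvalue `1 + (1 - 1/N) n`. -/
noncomputable def shiftEigenvalue (N n : ℕ) : ℝ := 1 + (1 - 1 / (N : ℝ)) * n

/-! The form becomes explicit once the product space is cut according to the first position `k` at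
which `x` and `y` differ. Since `lam ^ δ = N`, the kernel `d(x,y)^(-δ)` equals `N ^ k` there.
Expanding `(f x - f y) (g x - g y)` over the pairs lying in a common cylinder of length `j` gives `2
N^(-j) ⟪(1 - P_j) f, g⟫` by Fubini (`hasIntegral_incr_samePrefix`). The pairs with `k = j` therefore
contribute the bounded operator `(1 - P_j) - (1/N) (1 - P_{j+1})` to the form. On `Im Q_n` it is `1
- 1/N` for `j < n`, `1` for `j = n` and `0` for `j > n`; summing over `j` produces `1 + (1 - 1/N)
n`.

The sum over `j < m` is `truncLaplacian`, diagonal in the resolution `P_0, Q_0, Q_1, …`, with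
eigenvalues that are nonnegative, bounded by the final ones and eventually equal to them. Letting `m
→ ∞` recovers the form. Testing against `Q_n k`, which lies in the form domain, identifies the graph
of the Laplacian with the graph of multiplication by the eigenvalues (`mem_graph_Laplacian_iff`).
That the resolution sums to the identity is the density of locally constant functions (`tendsto_P`).

The remaining claims concern a diagonal operator with finite-dimensional eigenspaces, treated
abstractly in `IsSpectralFamily`. The semigroup is `∑ exp (-t a_n) R_n`; it is compact because its
eigenvalues tend to `0`, and its trace is, up to finitely many terms and a constant factor, a
geometric series of ratio `N exp (-t (1 - 1/N))`. Lipschitz functions lie in the domain because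
`‖Q_n f‖` decays like `lam ^ (-n)` while the eigenvalues grow linearly. They form a core because
they contain every spectral component. -/

section HeatSemigroup

/-! ### Semigroups on eigenvectors of their generator -/

variable {H : Type*} [NormedAddCommGroup H] [InnerProductSpace ℝ H]

/-- A strongly continuous semigroup multiplies an eigenvector of its generator by an exponential. -/
theorem IsHeatSemigroup.apply_of_mem_graph {A : H →ₗ.[ℝ] H} {T : ℝ≥0 → H →L[ℝ] H}
    (hT : IsHeatSemigroup A T) {f : H} {c : ℝ} (hf : (f, c • f) ∈ A.graph) (t : ℝ≥0) :
    T t f = Real.exp (-(t * c)) • f := by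
  -- The claim is that `w` is constant. The generator only provides a one-sided derivative at `0`,
  -- so the argument uses right derivatives throughout.
  set w : ℝ → H := fun s => Real.exp (s * c) • T s.toNNReal f with hw
  have hcont : Continuous w := by
    have := (hT.continuous f).comp continuous_real_toNNReal
    exact Continuous.smul (by fun_prop) this
  have hw0 : w 0 = f := by simp [hw, hT.map_zero]
  have hv : HasDerivWithinAt (fun s : ℝ => T s.toNNReal f) (-(c • f)) (Set.Ici 0) 0 := by
    rw [hasDerivWithinAt_iff_tendsto_slope]
    have h1 := ((hT.generator f (c • f)).1 hf).neg
    have h2 : Tendsto Real.toNNReal (𝓝[Set.Ici (0 : ℝ) \ {0}] 0) (𝓝[>] 0) := by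
      refine tendsto_nhdsWithin_iff.2 ⟨?_, ?_⟩
      · have := (continuous_real_toNNReal.tendsto 0).mono_left
          (nhdsWithin_le_nhds (s := Set.Ici (0 : ℝ) \ {0}))
        simpa using this
      · filter_upwards [self_mem_nhdsWithin] with s hs
        have h3 : 0 < s := lt_of_le_of_ne hs.1 (fun h => hs.2 h.symm)
        simpa using h3
    refine (h1.comp h2).congr' ?_
    filter_upwards [self_mem_nhdsWithin] with s hs
    have hs0 : (0 : ℝ) ≤ s := hs.1
    simp only [Function.comp_apply, slope_def_module, sub_zero, Real.toNNReal_zero, hT.map_zero,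
      ContinuousLinearMap.id_apply, Real.coe_toNNReal s hs0, ← smul_neg, neg_sub]
  have hwd : HasDerivWithinAt w 0 (Set.Ici 0) 0 := by
    have he : HasDerivWithinAt (fun s : ℝ => Real.exp (s * c)) c (Set.Ici 0) 0 := by
      have := ((hasDerivAt_id (0 : ℝ)).mul_const c).exp
      simpa using this.hasDerivWithinAt
    have := he.fun_smul hv
    simpa [hT.map_zero] using this
  -- The semigroup law gives `w y = exp (x c) T_x (w (y - x))` for `y ≥ x`, which carries the
  -- vanishing right derivative from `0` to `x`.
  have hshift (x : ℝ) (hx : 0 ≤ x) : HasDerivWithinAt w 0 (Set.Ici x) x := by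
    have h1 : HasDerivWithinAt (fun y : ℝ => w (y - x)) 0 (Set.Ici x) x := by
      have h0 : HasDerivWithinAt w 0 (Set.Ici 0) (x - x) := by rwa [sub_self]
      have h3 : HasDerivWithinAt (fun y : ℝ => y - x) 1 (Set.Ici x) x :=
        (hasDerivWithinAt_id x (Set.Ici x)).sub_const x
      have := HasDerivWithinAt.scomp (h := fun y : ℝ => y - x) x h0 h3 (fun y hy => sub_nonneg.2 (Set.mem_Ici.1 hy))
      rwa [smul_zero] at this
    have h2 := ((Real.exp (x * c) • T x.toNNReal).hasFDerivAt
      (x := w (x - x))).comp_hasDerivWithinAt x h1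
    rw [_root_.map_zero] at h2
    refine h2.congr_of_mem (fun y hy => ?_) Set.self_mem_Ici
    have hyx : 0 ≤ y - x := sub_nonneg.2 hy
    have hxy : y.toNNReal = x.toNNReal + (y - x).toNNReal := by
      rw [← Real.toNNReal_add hx hyx]; congr 1; ring
    simp only [hw, Function.comp_apply, _root_.smul_apply, map_smul, hxy, hT.map_add,
      ContinuousLinearMap.comp_apply, smul_smul, ← Real.exp_add]
    congr 2
    ring
  have hconst := constant_of_has_deriv_right_zero (f := w) (a := 0) (b := t) hcont.continuousOn
    (fun x hx => hshift x hx.1) t ⟨t.2, le_rfl⟩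
  rw [hw0] at hconst
  have : Real.exp (t * c) • T t f = f := by simpa [hw] using hconst
  conv_rhs => rw [← this, smul_smul, ← Real.exp_add, neg_add_cancel, Real.exp_zero, one_smul]

end HeatSemigroup

/-! ### Countable orthogonal resolutions of the identity -/

section SpectralFamily

universe u

variable {H : Type u} [NormedAddCommGroup H] [InnerProductSpace ℝ H] [CompleteSpace H]

/-- A sequence of mutually orthogonal projections that sums strongly to the identity. -/
structure IsSpectralFamily (R : ℕ → H →L[ℝ] H) : Prop where
  isStarProjection : ∀ n, IsStarProjection (R n)
  orthogonal : ∀ m n, m ≠ n → ∀ f, R m (R n f) = 0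
  hasSum : ∀ f, HasSum (fun n => R n f) f

namespace IsSpectralFamily

variable {R : ℕ → H →L[ℝ] H}

theorem orthogonalFamily_range (hproj : ∀ n, IsStarProjection (R n))
    (horth : ∀ m n, m ≠ n → ∀ f, R m (R n f) = 0) :
    OrthogonalFamily ℝ (fun n => (R n).range) fun n => (R n).range.subtypeₗᵢ := by
  rintro m n hmn ⟨_, f, rfl⟩ ⟨_, g, rfl⟩
  change ⟪R m f, R n g⟫_ℝ = 0
  rw [(hproj m).isSelfAdjoint.isSymmetric.apply_clm, horth m n hmn, inner_zero_right]

theorem idem (hR : IsSpectralFamily R) (n : ℕ) (f : H) : R n (R n f) = R n f :=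
  congrArg (fun T : H →L[ℝ] H => T f) (hR.isStarProjection n).isIdempotentElem

theorem inner_left (hR : IsSpectralFamily R) (n : ℕ) (f g : H) :
    ⟪R n f, g⟫_ℝ = ⟪f, R n g⟫_ℝ :=
  (hR.isStarProjection n).isSelfAdjoint.isSymmetric f g

theorem inner_apply_apply (hR : IsSpectralFamily R) (n : ℕ) (f g : H) :
    ⟪R n f, R n g⟫_ℝ = ⟪R n f, g⟫_ℝ := by
  rw [← hR.inner_left, hR.idem]

theorem hasSum_inner (hR : IsSpectralFamily R) (f g : H) :
    HasSum (fun n => ⟪R n f, g⟫_ℝ) ⟪f, g⟫_ℝ := by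
  have h : (fun n => ⟪R n f, g⟫_ℝ) = fun n => ⟪g, R n f⟫_ℝ := funext fun n => real_inner_comm _ _
  rw [h, real_inner_comm g f]
  exact (hR.hasSum f).mapL (innerSL ℝ g)

theorem hasSum_norm_sq (hR : IsSpectralFamily R) (f : H) :
    HasSum (fun n => ‖R n f‖ ^ 2) (‖f‖ ^ 2) := by
  simpa only [real_inner_self_eq_norm_sq, ← hR.inner_apply_apply _ f f] using hR.hasSum_inner f f

theorem ext (hR : IsSpectralFamily R) {f g : H} (h : ∀ n, R n f = R n g) : f = g :=
  (hR.hasSum f).unique (by simpa only [h] using hR.hasSum g)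

theorem map_eq_of_forall (hR : IsSpectralFamily R) {S T : H →L[ℝ] H}
    (h : ∀ n f, S (R n f) = T (R n f)) : S = T := by
  ext f
  exact ((hR.hasSum f).mapL S).unique (by simpa only [h] using (hR.hasSum f).mapL T)

theorem norm_le (hR : IsSpectralFamily R) {f g : H} {C : ℝ} (hC : 0 ≤ C)
    (h : ∀ n, ‖R n g‖ ≤ C * ‖R n f‖) : ‖g‖ ≤ C * ‖f‖ := by
  refine le_of_sq_le_sq ?_ (by positivity)
  rw [mul_pow]
  refine hasSum_le (fun n => ?_) (hR.hasSum_norm_sq g) ((hR.hasSum_norm_sq f).mul_left (C ^ 2))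
  rw [← mul_pow]
  exact pow_le_pow_left₀ (norm_nonneg _) (h n) 2

theorem hasSum_smul (hR : IsSpectralFamily R) {c : ℕ → ℝ} {f h : H}
    (hh : ∀ n, R n h = c n • R n f) : HasSum (fun n => c n • R n f) h := by
  simpa only [hh] using hR.hasSum h

theorem summable_sq_of_smul (hR : IsSpectralFamily R) {c : ℕ → ℝ} {f h : H}
    (hh : ∀ n, R n h = c n • R n f) : Summable fun n => c n ^ 2 * ‖R n f‖ ^ 2 := by
  have := (hR.hasSum_norm_sq h).summable
  simpa only [hh, norm_smul, mul_pow, Real.norm_eq_abs, sq_abs] using this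

/-- The terms `R n f` are summable as soon as their partial sums converge. -/
theorem of_tendsto_sum_range (hproj : ∀ n, IsStarProjection (R n))
    (horth : ∀ m n, m ≠ n → ∀ f, R m (R n f) = 0)
    (hlim : ∀ f, Tendsto (fun m => ∑ n ∈ Finset.range m, R n f) atTop (𝓝 f)) :
    IsSpectralFamily R where
  isStarProjection := hproj
  orthogonal := horth
  hasSum f := by
    have h1 (n : ℕ) : ⟪R n f, f⟫_ℝ = ‖R n f‖ ^ 2 := by
      rw [← real_inner_self_eq_norm_sq, ← (hproj n).isSelfAdjoint.isSymmetric.apply_clm]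
      exact congrArg (fun T : H →L[ℝ] H => ⟪T f, f⟫_ℝ) (hproj n).isIdempotentElem.symm
    -- Pairing the partial sums with `f` shows that the squared norms have convergent partial sums;
    -- orthogonality upgrades this to unconditional summability.
    have h2 : Summable fun n => ‖R n f‖ ^ 2 := by
      refine ((hasSum_iff_tendsto_nat_of_nonneg (fun n => by positivity) ⟪f, f⟫_ℝ).2 ?_).summable
      simpa only [sum_inner, h1] using
        (hlim f).inner (𝕜 := ℝ) (tendsto_const_nhds (x := f))
    have h3 : Summable fun n => R n f :=
      ((orthogonalFamily_range hproj horth).summable_iff_norm_sq_summable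
        (fun n => (⟨R n f, f, rfl⟩ : (R n).range))).2 h2
    have h4 := h3.hasSum
    rwa [tendsto_nhds_unique h4.tendsto_sum_nat (hlim f)] at h4

/-! ### Multiplication operators in a spectral family -/

theorem exists_smul_of_summable (hR : IsSpectralFamily R) {c : ℕ → ℝ} {f : H}
    (hs : Summable fun n => c n ^ 2 * ‖R n f‖ ^ 2) : ∃ h, ∀ n, R n h = c n • R n f := by
  have key := ((orthogonalFamily_range hR.isStarProjection hR.orthogonal).summable_iff_norm_sq_summable
    (fun n => (⟨c n • R n f, (R n).range.smul_mem _ ⟨f, rfl⟩⟩ : (R n).range))).2 (by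
      simpa only [Submodule.coe_norm, norm_smul, mul_pow, Real.norm_eq_abs, sq_abs] using hs)
  obtain ⟨h, hh⟩ := key
  refine ⟨h, fun n => (hh.mapL (R n)).unique ?_⟩
  have h1 := hasSum_ite_eq n (c n • R n f)
  convert h1 using 2 with m
  change R n (c m • R m f) = _
  split_ifs with hm
  · subst hm; rw [map_smul, hR.idem]
  · rw [map_smul, hR.orthogonal n m (Ne.symm hm), smul_zero]

/-- A bounded sequence `c` defines the operator `∑ c_n R_n`. -/
theorem exists_multiplier (hR : IsSpectralFamily R) (c : ℕ → ℝ) (C : ℝ) (hc : ∀ n, |c n| ≤ C) :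
    ∃ T : H →L[ℝ] H, ∀ n f, R n (T f) = c n • R n f := by
  have hC : 0 ≤ C := (abs_nonneg _).trans (hc 0)
  have hs (f : H) : ∃ h, ∀ n, R n h = c n • R n f := by
    refine hR.exists_smul_of_summable
      (((hR.hasSum_norm_sq f).summable.mul_left (C ^ 2)).of_nonneg_of_le (fun n => by positivity)
        fun n => ?_)
    exact mul_le_mul_of_nonneg_right
      (sq_le_sq' (neg_le_of_abs_le (hc n)) (le_of_abs_le (hc n))) (by positivity)
  choose T hT using hs
  refine ⟨LinearMap.mkContinuous
    { toFun := T
      map_add' := fun f g => hR.ext fun n => by simp only [map_add, hT, smul_add]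
      map_smul' := fun a f => hR.ext fun n => by
        simp only [map_smul, hT, RingHom.id_apply, smul_comm a] } C fun f => ?_, fun n f => hT f n⟩
  refine hR.norm_le hC fun n => ?_
  change ‖R n (T f)‖ ≤ _
  rw [hT, norm_smul]
  gcongr
  exact hc n

theorem multiplier_apply_apply (hR : IsSpectralFamily R) {c : ℕ → ℝ} {T : H →L[ℝ] H}
    (hT : ∀ n f, R n (T f) = c n • R n f) (n : ℕ) (f : H) : T (R n f) = c n • R n f := by
  refine hR.ext fun m => ?_
  rw [hT, map_smul]
  rcases eq_or_ne m n with rfl | h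
  · rfl
  · rw [hR.orthogonal m n h, smul_zero, smul_zero]

theorem multiplier_isSymmetric (hR : IsSpectralFamily R) {c : ℕ → ℝ} {T : H →L[ℝ] H}
    (hT : ∀ n f, R n (T f) = c n • R n f) (f g : H) : ⟪T f, g⟫_ℝ = ⟪f, T g⟫_ℝ := by
  refine (hR.hasSum_inner (T f) g).unique ?_
  convert hR.hasSum_inner f (T g) using 2 with n
  rw [← hR.inner_apply_apply n f (T g), hT, hT, real_inner_smul_left, real_inner_smul_right,
    hR.inner_apply_apply]

theorem multiplier_hasSum_inner (hR : IsSpectralFamily R) {c : ℕ → ℝ} {T : H →L[ℝ] H}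
    (hT : ∀ n f, R n (T f) = c n • R n f) (f : H) :
    HasSum (fun n => c n * ‖R n f‖ ^ 2) ⟪T f, f⟫_ℝ := by
  convert hR.hasSum_inner (T f) f using 2 with n
  rw [hT, real_inner_smul_left, ← hR.inner_apply_apply, real_inner_self_eq_norm_sq]

/-- Uniformly bounded pointwise convergence of multipliers gives strong convergence. -/
theorem tendsto_of_multiplier (hR : IsSpectralFamily R) {α : Type*} {l : Filter α} {f g₀ : H}
    {g : α → H} {m : α → ℕ → ℝ} {m₀ : ℕ → ℝ} {C : ℝ} (hg : ∀ᶠ a in l, ∀ n, R n (g a) = m a n • R n f)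
    (hg₀ : ∀ n, R n g₀ = m₀ n • R n f) (hb : ∀ᶠ a in l, ∀ n, |m a n - m₀ n| ≤ C)
    (hm : ∀ n, Tendsto (fun a => m a n) l (𝓝 (m₀ n))) : Tendsto g l (𝓝 g₀) := by
  rw [tendsto_iff_norm_sub_tendsto_zero]
  have h2 : Tendsto (fun a => ∑' n, (m a n - m₀ n) ^ 2 * ‖R n f‖ ^ 2) l
      (𝓝 (∑' n, (m₀ n - m₀ n) ^ 2 * ‖R n f‖ ^ 2)) := by
    refine tendsto_tsum_of_dominated_convergence
      ((hR.hasSum_norm_sq f).summable.mul_left (C ^ 2)) (fun n => ?_) ?_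
    · exact (((hm n).sub_const _).pow 2).mul_const _
    · filter_upwards [hb] with a ha n
      rw [Real.norm_of_nonneg (by positivity)]
      exact mul_le_mul_of_nonneg_right
        (sq_le_sq' (neg_le_of_abs_le (ha n)) (le_of_abs_le (ha n))) (by positivity)
  simp only [sub_self, ne_eq, OfNat.ofNat_ne_zero, not_false_eq_true, zero_pow, zero_mul,
    tsum_zero] at h2
  have h3 : Tendsto (fun a => ‖g a - g₀‖ ^ 2) l (𝓝 0) := by
    refine h2.congr' ?_
    filter_upwards [hg] with a ha
    rw [← (hR.hasSum_norm_sq (g a - g₀)).tsum_eq]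
    congr 1
    ext n
    rw [map_sub, ha, hg₀, ← sub_smul, norm_smul, mul_pow, Real.norm_eq_abs, sq_abs]
  simpa [Real.sqrt_sq (norm_nonneg _)] using h3.sqrt

/-! ### Compactness and trace -/

/-- `T` is the norm limit of its finite-rank partial sums: the error of the `m`-th one is at most
the supremum of `|c k|` over `k ≥ m`. -/
theorem isCompactOperator_of_tendsto_zero (hR : IsSpectralFamily R)
    (hfin : ∀ n, FiniteDimensional ℝ (R n).range) {c : ℕ → ℝ} (hc : Tendsto c atTop (𝓝 0))
    {T : H →L[ℝ] H} (hT : ∀ n f, R n (T f) = c n • R n f) : IsCompactOperator T := by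
  have hcomp (n : ℕ) : IsCompactOperator (R n) := by
    have := hfin n
    have h1 := isCompactOperator_of_locallyCompactSpace_rng ((R n).range.subtypeL)
    exact h1.comp_clm ((R n).codRestrict (R n).range fun f => ⟨f, rfl⟩)
  have hsum (m : ℕ) : IsCompactOperator (∑ n ∈ Finset.range m, c n • R n : H →L[ℝ] H) := by
    induction m with
    | zero => simpa using isCompactOperator_zero
    | succ m ih => rw [Finset.sum_range_succ]; exact ih.add ((hcomp m).smul (c m))
  refine isCompactOperator_of_tendsto (l := atTop)
    (F := fun m => ∑ n ∈ Finset.range m, c n • R n) ?_ (Eventually.of_forall hsum)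
  rw [Metric.tendsto_atTop]
  intro ε hε
  obtain ⟨M, hM⟩ := Metric.tendsto_atTop.1 hc (ε / 2) (by positivity)
  refine ⟨M, fun m hm => lt_of_le_of_lt ?_ (half_lt_self hε)⟩
  rw [dist_eq_norm]
  refine ContinuousLinearMap.opNorm_le_bound _ (by positivity) fun f => ?_
  refine hR.norm_le (by positivity) fun k => ?_
  have h1 : R k (∑ n ∈ Finset.range m, c n • R n f) = if k < m then c k • R k f else 0 := by
    rw [map_sum]
    split_ifs with hk
    · rw [Finset.sum_eq_single k]
      · rw [map_smul, hR.idem]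
      · intro n _ hn
        rw [map_smul, hR.orthogonal k n hn.symm, smul_zero]
      · intro h; simp [hk] at h
    · refine Finset.sum_eq_zero fun n hn => ?_
      rw [Finset.mem_range] at hn
      rw [map_smul, hR.orthogonal k n (by omega), smul_zero]
  have h2 : R k ((∑ n ∈ Finset.range m, c n • R n - T : H →L[ℝ] H) f) =
      R k (∑ n ∈ Finset.range m, c n • R n f) - R k (T f) := by
    simp
  rw [h2, h1, hT]
  split_ifs with hk
  · rw [sub_self, norm_zero]; positivity
  · rw [zero_sub, norm_neg, norm_smul]
    gcongr
    have := hM k (by omega)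
    rw [dist_zero_right] at this
    exact this.le

/-- The Hilbert-Schmidt norm of a finite rank orthogonal projection. -/
theorem _root_.IsStarProjection.hasSum_norm_sq_hilbertBasis {p : H →L[ℝ] H}
    (hp : IsStarProjection p) [FiniteDimensional ℝ p.range] {ι : Type*} (b : HilbertBasis ι ℝ H) :
    HasSum (fun i => ‖p (b i)‖ ^ 2) (Module.finrank ℝ p.range) := by
  let e := stdOrthonormalBasis ℝ p.range
  -- Parseval for each vector `e j` of an orthonormal basis of the range; summing over `j` counts
  -- the dimension.
  have h1 (j) : HasSum (fun i => ⟪(e j : H), b i⟫_ℝ ^ 2) 1 := by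
    have := b.hasSum_inner_mul_inner (e j : H) (e j)
    rw [real_inner_self_eq_norm_sq, ← Submodule.coe_norm, e.norm_eq_one, one_pow] at this
    simpa only [sq, real_inner_comm] using this
  have h2 := hasSum_sum fun j (_ : j ∈ Finset.univ) => h1 j
  simp only [Finset.sum_const, Finset.card_univ, Fintype.card_fin, nsmul_eq_mul, mul_one] at h2
  convert h2 using 2 with i
  have h3 := e.sum_sq_norm_inner_right (⟨p (b i), b i, rfl⟩ : p.range)
  rw [Submodule.coe_norm] at h3
  rw [← h3]
  refine Finset.sum_congr rfl fun j _ => ?_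
  obtain ⟨v, hv⟩ := (e j).2
  rw [Submodule.coe_inner, Real.norm_eq_abs, sq_abs]
  congr 1
  change ⟪(e j : H), p (b i)⟫_ℝ = _
  have hv' : p v = (e j : H) := hv
  rw [← hp.isSelfAdjoint.isSymmetric.apply_clm, ← hv']
  exact congrArg (fun T : H →L[ℝ] H => ⟪T v, b i⟫_ℝ) hp.isIdempotentElem

/-- The diagonal of a positive multiplier is summable iff the eigenvalues, with multiplicity, are. -/
theorem summable_diagonal_iff (hR : IsSpectralFamily R)
    (hfin : ∀ n, FiniteDimensional ℝ (R n).range) {c : ℕ → ℝ} (hc : ∀ n, 0 ≤ c n) {T : H →L[ℝ] H}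
    (hT : ∀ n f, R n (T f) = c n • R n f) {ι : Type*} (b : HilbertBasis ι ℝ H) :
    (Summable fun i => ⟪T (b i), b i⟫_ℝ) ↔
      Summable fun n => c n * Module.finrank ℝ (R n).range := by
  have h1 (n : ℕ) : HasSum (fun i => c n * ‖R n (b i)‖ ^ 2) (c n * Module.finrank ℝ (R n).range) :=
    ((hR.isStarProjection n).hasSum_norm_sq_hilbertBasis b).mul_left (c n)
  have h2 (i : ι) := hR.multiplier_hasSum_inner hT (b i)
  -- Tonelli for the nonnegative family `c n ‖R n (b i)‖²`: summing first over `i` gives the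
  -- multiplicities, first over `n` the diagonal of `T`.
  have e1 := summable_prod_of_nonneg (f := fun p : ℕ × ι => c p.1 * ‖R p.1 (b p.2)‖ ^ 2)
    (fun p => mul_nonneg (hc _) (by positivity))
  have e2 := summable_prod_of_nonneg (f := fun p : ι × ℕ => c p.2 * ‖R p.2 (b p.1)‖ ^ 2)
    (fun p => mul_nonneg (hc _) (by positivity))
  simp only [fun n => (h1 n).tsum_eq, fun n => (h1 n).summable, implies_true, true_and] at e1
  simp only [fun n => (h2 n).tsum_eq, fun n => (h2 n).summable, implies_true, true_and] at e2
  rw [← e1, ← e2]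
  exact (Equiv.prodComm ι ℕ).summable_iff
    (f := fun p : ℕ × ι => c p.1 * ‖R p.1 (b p.2)‖ ^ 2)

/-- `T` is positive, so the operator `|T|` of the definition must be `T` itself, and its diagonal in
any Hilbert basis is controlled by `summable_diagonal_iff`. -/
theorem isTraceClass_iff (hR : IsSpectralFamily R)
    (hfin : ∀ n, FiniteDimensional ℝ (R n).range) {c : ℕ → ℝ} (hc : ∀ n, 0 < c n) {T : H →L[ℝ] H}
    (hT : ∀ n f, R n (T f) = c n • R n f) :
    IsTraceClass T ↔ Summable fun n => c n * Module.finrank ℝ (R n).range := by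
  have hsymm := hR.multiplier_isSymmetric hT
  have hadj : ContinuousLinearMap.adjoint T = T :=
    (ContinuousLinearMap.isSelfAdjoint_iff_isSymmetric.2 hsymm)
  constructor
  · rintro ⟨S, hS, hS2, hSb⟩
    have hST : S = T := by
      refine hR.map_eq_of_forall fun n f => ?_
      rw [hR.multiplier_apply_apply hT]
      have h1 : S (S (R n f)) = (c n * c n) • R n f := by
        have := congrArg (fun A : H →L[ℝ] H => A (R n f)) hS2
        simp only [hadj, ContinuousLinearMap.comp_apply] at this
        rw [this, hR.multiplier_apply_apply hT, map_smul, hR.multiplier_apply_apply hT, mul_smul]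
      -- Uniqueness of the positive square root on the eigenspace: `S² = c²` there gives `S v = -c
      -- v`, and positivity of `S` with `c > 0` forces `v = 0`.
      set v := S (R n f) - c n • R n f with hv
      have h2 : S v = -(c n • v) := by
        rw [hv, map_sub, map_smul, h1, smul_sub, mul_smul]; abel
      have h3 := hS.inner_nonneg_left v
      rw [h2, inner_neg_left, real_inner_smul_left, real_inner_self_eq_norm_sq] at h3
      have h4 : ‖v‖ ^ 2 = 0 := by
        have := hc n
        have h5 : 0 ≤ ‖v‖ ^ 2 := by positivity
        nlinarith
      have h5 : v = 0 := by simpa using h4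
      exact sub_eq_zero.1 h5
    obtain ⟨w, b, -⟩ := exists_hilbertBasis ℝ H
    rw [← hR.summable_diagonal_iff hfin (fun n => (hc n).le) hT b]
    simpa only [hST] using hSb w b
  · intro h
    refine ⟨T, ⟨hsymm, fun f => ?_⟩, by rw [hadj], fun ι b =>
      (hR.summable_diagonal_iff hfin (fun n => (hc n).le) hT b).2 h⟩
    exact (hR.multiplier_hasSum_inner hT f).nonneg fun n => mul_nonneg (hc n).le (by positivity)

/-! ### The heat semigroup -/

/-- A bound on the difference quotients uniform in `t`, needed for dominated convergence over the
spectrum. -/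
theorem _root_.Real.one_sub_exp_neg_div_mem {a t : ℝ} (ha : 0 ≤ a) (ht : 0 < t) :
    0 ≤ t⁻¹ * (1 - Real.exp (-(t * a))) ∧ t⁻¹ * (1 - Real.exp (-(t * a))) ≤ a := by
  have h1 : Real.exp (-(t * a)) ≤ 1 := Real.exp_le_one_iff.2 (by nlinarith)
  have h2 := Real.add_one_le_exp (-(t * a))
  refine ⟨mul_nonneg (by positivity) (by linarith), ?_⟩
  rw [inv_mul_le_iff₀ ht]
  linarith

theorem _root_.Real.tendsto_one_sub_exp_neg_div (a : ℝ) :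
    Tendsto (fun t : ℝ≥0 => (t : ℝ)⁻¹ * (1 - Real.exp (-(t * a)))) (𝓝[>] 0) (𝓝 a) := by
  have h : HasDerivAt (fun t : ℝ => -Real.exp (-(t * a))) a 0 := by
    have h1 : HasDerivAt (fun t : ℝ => -(t * a)) (-a) 0 := by
      simpa using (((hasDerivAt_id (0 : ℝ)).mul_const a).fun_neg)
    simpa using h1.exp.fun_neg
  have h2 := (hasDerivAt_iff_tendsto_slope.1 h).comp (g := fun t : ℝ => slope _ 0 t)
    (f := fun t : ℝ≥0 => (t : ℝ)) (x := 𝓝[>] 0) (y := 𝓝[≠] 0) (by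
      refine tendsto_nhdsWithin_iff.2 ⟨?_, ?_⟩
      · exact (NNReal.continuous_coe.tendsto 0).mono_left nhdsWithin_le_nhds
      · filter_upwards [self_mem_nhdsWithin] with t (ht : 0 < t)
        simpa using ht.ne')
  refine h2.congr fun t => ?_
  simp [slope_def_field]
  ring

variable {A : H →ₗ.[ℝ] H} {a : ℕ → ℝ}

/-- A multiplication operator with nonnegative eigenvalues generates `∑ exp (-t a_n) R_n`. -/
theorem isHeatSemigroup (hR : IsSpectralFamily R) (ha : ∀ n, 0 ≤ a n)
    (hA : ∀ f h, (f, h) ∈ A.graph ↔ ∀ n, R n h = a n • R n f) {T : ℝ≥0 → H →L[ℝ] H}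
    (hT : ∀ t n f, R n (T t f) = Real.exp (-(t * a n)) • R n f) : IsHeatSemigroup A T where
  map_zero := by
    ext f
    refine hR.ext fun n => ?_
    rw [hT]; simp
  map_add s t := by
    ext f
    refine hR.ext fun n => ?_
    rw [ContinuousLinearMap.comp_apply, hT, hT, hT, smul_smul, ← Real.exp_add]
    congr 2
    push_cast
    ring
  continuous f := by
    refine continuous_iff_continuousAt.2 fun t₀ => ?_
    refine hR.tendsto_of_multiplier (C := 2) (Eventually.of_forall fun t n => hT t n f) (hT t₀ · f)
      (Eventually.of_forall fun t n => ?_) fun n => ?_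
    · have h (s : ℝ≥0) : Real.exp (-(s * a n)) ≤ 1 :=
        Real.exp_le_one_iff.2 (neg_nonpos.2 (mul_nonneg s.2 (ha n)))
      have h1 := h t
      have h2 := h t₀
      have h3 := Real.exp_pos (-(t * a n))
      have h4 := Real.exp_pos (-(t₀ * a n))
      rw [abs_le]; constructor <;> linarith
    · have : Continuous fun t : ℝ≥0 => Real.exp (-(t * a n)) := by fun_prop
      exact this.tendsto t₀
  generator f h := by
    have hdiff (t : ℝ≥0) (n : ℕ) : R n ((t : ℝ)⁻¹ • (f - T t f)) =
        ((t : ℝ)⁻¹ * (1 - Real.exp (-(t * a n)))) • R n f := by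
      rw [map_smul, map_sub, hT, mul_smul, sub_smul, one_smul]
    rw [hA]
    constructor
    · intro hh
      -- `h` is used as the reference vector, so that the multipliers are bounded by `1`
      refine hR.tendsto_of_multiplier (f := h) (C := 1) (m₀ := fun _ => 1)
        (m := fun t n => ((t : ℝ)⁻¹ * (1 - Real.exp (-(t * a n)))) / a n + if a n = 0 then 1 else 0)
        ?_ (fun n => (one_smul ℝ _).symm) ?_ fun n => ?_
      · filter_upwards with t n
        rw [hdiff, hh, smul_smul]
        -- If `a n = 0`, then `R n h = 0` and the multiplier is irrelevant; the value `1` only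
        -- serves to keep the limit equal to `m₀ = 1`.
        by_cases h0 : a n = 0
        · simp [h0]
        · rw [if_neg h0, add_zero, div_mul_cancel₀ _ h0]
      · filter_upwards [self_mem_nhdsWithin] with t (ht : 0 < t) n
        by_cases h0 : a n = 0
        · simp [h0]
        · have hpos : 0 < a n := lt_of_le_of_ne (ha n) (Ne.symm h0)
          obtain ⟨h1, h2⟩ := Real.one_sub_exp_neg_div_mem (ha n) (t := t) ht
          have h3 := div_nonneg h1 hpos.le
          have h4 := (div_le_one hpos).2 h2
          rw [if_neg h0, add_zero, abs_le]
          constructor <;> linarith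
      · by_cases h0 : a n = 0
        · simp [h0]
        · simpa [h0] using (Real.tendsto_one_sub_exp_neg_div (a n)).div_const (a n)
    · intro hlim n
      have h1 := ((R n).continuous.tendsto h).comp hlim
      have h2 := (Real.tendsto_one_sub_exp_neg_div (a n)).smul_const (R n f)
      refine tendsto_nhds_unique h1 (h2.congr fun t => ?_)
      exact (hdiff t n).symm

/-- Each `R n f` is an eigenvector of `A`, on which any semigroup generated by `-A` is determined;
these vectors span a dense subspace. -/
theorem isHeatSemigroup_unique (hR : IsSpectralFamily R)
    (hA : ∀ f h, (f, h) ∈ A.graph ↔ ∀ n, R n h = a n • R n f) {T T' : ℝ≥0 → H →L[ℝ] H}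
    (hT : IsHeatSemigroup A T) (hT' : IsHeatSemigroup A T') : T' = T := by
  ext1 t
  refine hR.map_eq_of_forall fun n f => ?_
  have hg : (R n f, a n • R n f) ∈ A.graph := by
    refine (hA _ _).2 fun m => ?_
    rw [map_smul]
    rcases eq_or_ne m n with rfl | h
    · rfl
    · rw [hR.orthogonal m n h, smul_zero, smul_zero]
  rw [hT.apply_of_mem_graph hg, hT'.apply_of_mem_graph hg]

/-! ### Cores -/

/-- The graph of `A` is closed, and a point `(f, h)` of it is the limit of the partial sums of `(R n
f, R n h)`, which lie in the graph over `S`. -/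
theorem hasCore (hR : IsSpectralFamily R)
    (hA : ∀ f h, (f, h) ∈ A.graph ↔ ∀ n, R n h = a n • R n f) {S : Submodule ℝ H}
    (hS : S ≤ A.domain) (hRS : ∀ n f, R n f ∈ S) : A.HasCore S := by
  have hgraph : (A.graph : Set (H × H)) = {p | ∀ n, R n p.2 = a n • R n p.1} :=
    Set.ext fun p => hA p.1 p.2
  have hclosed : A.IsClosed := by
    change _root_.IsClosed (A.graph : Set (H × H))
    rw [hgraph, Set.ofPred_forall]
    exact isClosed_iInter fun n => isClosed_eq (by fun_prop) (by fun_prop)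
  have hle : A.domRestrict S ≤ A := LinearPMap.domRestrict_le
  have hcl : (A.domRestrict S).IsClosable := hclosed.isClosable.leIsClosable hle
  refine ⟨hS, LinearPMap.eq_of_eq_graph (le_antisymm ?_ ?_)⟩
  · rw [← hcl.graph_closure_eq_closure_graph]
    exact Submodule.topologicalClosure_minimal _ (LinearPMap.le_graph_of_le hle) hclosed
  · rw [← hcl.graph_closure_eq_closure_graph]
    rintro ⟨f, h⟩ hp
    have hp' := (hA f h).1 hp
    have hsum : HasSum (fun n => (R n f, R n h)) (f, h) := (hR.hasSum f).prodMk (hR.hasSum h)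
    refine mem_closure_of_tendsto (hsum : Tendsto _ _ _)
      (Eventually.of_forall fun s => Submodule.sum_mem _ fun n _ => ?_)
    have hn : (R n f, R n h) ∈ A.graph := (hA _ _).2 fun m => by
      rcases eq_or_ne m n with rfl | hmn
      · rw [hR.idem, hR.idem, hp']
      · rw [hR.orthogonal m n hmn, hR.orthogonal m n hmn, smul_zero]
    obtain ⟨y, hy, hy'⟩ := A.mem_graph_iff.1 hn
    have hyS : (y : H) ∈ S := by rw [hy]; exact hRS n f
    exact (A.domRestrict S).mem_graph_iff.2
      ⟨⟨y, hyS, y.2⟩, hy, (LinearPMap.domRestrict_apply rfl).trans hy'⟩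

end IsSpectralFamily

end SpectralFamily

/-! ### Cylinders and locally constant functions on the full shift -/

namespace FullShift

variable {N : ℕ} {lam : ℝ}

/-- The word of the first `n` letters of `x`. -/
def initialWord (n : ℕ) (x : FullShift N lam) : Fin n → Fin N := fun k => x k

theorem mem_cyl_iff {n : ℕ} {w : Fin n → Fin N} {x : FullShift N lam} :
    x ∈ cyl w ↔ initialWord n x = w :=
  funext_iff.symm

theorem initialWord_eq_iff {n : ℕ} {x y : FullShift N lam} :
    initialWord n x = initialWord n y ↔ ∀ k < n, x k = y k :=
  funext_iff.trans ⟨fun h k hk => h ⟨k, hk⟩, fun h k => h k k.2⟩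

theorem initialWord_eq_iff_le_firstDiff {n : ℕ} {x y : FullShift N lam} (hxy : x ≠ y) :
    initialWord n x = initialWord n y ↔ n ≤ PiNat.firstDiff (E := fun _ => Fin N) x y :=
  initialWord_eq_iff.trans (PiNat.mem_cylinder_iff_le_firstDiff (E := fun _ => Fin N) hxy n)

theorem measurableSet_initialWord_eq (n : ℕ) :
    MeasurableSet {p : FullShift N lam × FullShift N lam |
      initialWord n p.1 = initialWord n p.2} := by
  have h : {p : FullShift N lam × FullShift N lam | initialWord n p.1 = initialWord n p.2} =
      ⋃ w : Fin n → Fin N, cyl w ×ˢ cyl w := by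
    ext p
    simp [mem_cyl_iff, eq_comm]
  rw [h]
  exact MeasurableSet.iUnion fun w => (measurableSet_cyl w).prod (measurableSet_cyl w)

theorem alphabet_pos [hN : N.AtLeastTwo] : 0 < N := lt_of_lt_of_le two_pos hN.prop

theorem one_lt_alphabet [hN : N.AtLeastTwo] : (1 : ℝ) < N :=
  Nat.one_lt_cast.2 hN.prop

/-! ### Cylinders as balls -/

section Metric

variable [hlam : Fact (1 < lam)]

theorem dist_le_of_initialWord_eq {n : ℕ} {x y : FullShift N lam}
    (h : initialWord n x = initialWord n y) : dist x y ≤ (lam ^ n)⁻¹ :=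
  shiftDist_le_of_mem_cylinder hlam.out x y n (initialWord_eq_iff.1 h)

theorem tendsto_inv_pow : Tendsto (fun n : ℕ => (lam ^ n)⁻¹) atTop (𝓝 0) := by
  simpa only [inv_pow] using
    tendsto_pow_atTop_nhds_zero_of_lt_one (inv_nonneg.2 (one_pos.trans hlam.out).le)
      (inv_lt_one_of_one_lt₀ hlam.out)

instance : CompactSpace (FullShift N lam) :=
  inferInstanceAs (CompactSpace (ℕ → Fin N))

end Metric

/-! ### Cylinder functions and the projections onto them -/

section L2

variable [N.AtLeastTwo]

theorem measureReal_cyl {n : ℕ} (w : Fin n → Fin N) :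
    (bernoulliMeasure N lam).real (cyl w) = ((N : ℝ) ^ n)⁻¹ := by
  -- The cylinder is written as a product set over finitely many coordinates, the form required by
  -- the product measure. The value `Set.univ` is never used.
  have h : (cyl w : Set (FullShift N lam)) = Set.pi (Finset.range n : Set ℕ)
      (fun k => if h : k < n then {w ⟨k, h⟩} else Set.univ) := by
    ext x
    refine ⟨fun hx k hk => ?_, fun hx k => ?_⟩
    · have hk' : k < n := Finset.mem_range.1 hk
      simpa [hk'] using hx ⟨k, hk'⟩
    · have := hx k (Finset.mem_coe.2 (Finset.mem_range.2 k.2))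
      simpa using this
  have : NeZero N := ⟨alphabet_pos.ne'⟩
  have key : Measure.infinitePi (fun _ : ℕ => ProbabilityTheory.uniformOn (Set.univ : Set (Fin N)))
      (Set.pi (Finset.range n : Set ℕ)
        (fun k => if h : k < n then {w ⟨k, h⟩} else Set.univ)) = ((N : ENNReal) ^ n)⁻¹ := by
    rw [Measure.infinitePi_pi _ fun k _ => MeasurableSet.of_discrete,
      Finset.prod_congr rfl (g := fun _ => ((N : ENNReal))⁻¹) (fun k hk => by
        rw [dif_pos (Finset.mem_range.1 hk)]
        simp [ProbabilityTheory.uniformOn, ProbabilityTheory.cond])]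
    simp [ENNReal.inv_pow]
  have hμ : bernoulliMeasure N lam (cyl w) = ((N : ENNReal) ^ n)⁻¹ := by
    rw [h]; exact key
  rw [measureReal_def, hμ]
  simp

variable (N lam) in
/-- The Hilbert space of square integrable functions on the full shift. -/
noncomputable abbrev L2 := Lp ℝ 2 (bernoulliMeasure N lam)

/-- The class of the characteristic function of a cylinder set. -/
noncomputable def cylInd {n : ℕ} (w : Fin n → Fin N) : L2 N lam :=
  indicatorConstLp 2 (measurableSet_cyl w) (measure_ne_top (bernoulliMeasure N lam) _) (1 : ℝ)

theorem cylInd_coeFn {n : ℕ} (w : Fin n → Fin N) :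
    (cylInd w : L2 N lam) =ᵐ[bernoulliMeasure N lam] (cyl w).indicator fun _ => 1 :=
  indicatorConstLp_coeFn

theorem inner_cylInd {n : ℕ} (w : Fin n → Fin N) (f : L2 N lam) :
    ⟪cylInd w, f⟫_ℝ = ∫ x in cyl w, f x ∂bernoulliMeasure N lam :=
  L2.inner_indicatorConstLp_one _ _ f

theorem inner_cylInd_cylInd {n : ℕ} (w w' : Fin n → Fin N) :
    ⟪(cylInd w : L2 N lam), cylInd w'⟫_ℝ = if w = w' then ((N : ℝ) ^ n)⁻¹ else 0 := by
  rw [cylInd, cylInd, L2.real_inner_indicatorConstLp_one_indicatorConstLp_one]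
  split_ifs with h
  · rw [h, Set.inter_self, measureReal_cyl]
  · have : (cyl w ∩ cyl w' : Set (FullShift N lam)) = ∅ := by
      ext x
      simp only [Set.mem_inter_iff, mem_cyl_iff, Set.mem_empty_iff_false, iff_false, not_and]
      rintro rfl
      exact h
    rw [this, measureReal_empty]

theorem cylInd_mem_V {n : ℕ} (w : Fin n → Fin N) : cylInd w ∈ V N lam n :=
  Submodule.subset_span ⟨w, rfl⟩

theorem P_apply (n : ℕ) (f : L2 N lam) :
    P N lam n f = ∑ w : Fin n → Fin N, ((N : ℝ) ^ n * ⟪cylInd w, f⟫_ℝ) • cylInd w := by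
  have hN : (N : ℝ) ^ n ≠ 0 := pow_ne_zero _ (by have := one_lt_alphabet (N := N); positivity)
  refine Submodule.eq_starProjection_of_mem_of_inner_eq_zero
    (Submodule.sum_mem _ fun w _ => Submodule.smul_mem _ _ (cylInd_mem_V w)) fun g hg => ?_
  induction hg using Submodule.span_induction with
  | mem g hg =>
    obtain ⟨w, rfl⟩ := hg
    change ⟪_, cylInd w⟫_ℝ = 0
    rw [inner_sub_left, sum_inner]
    simp only [real_inner_smul_left, inner_cylInd_cylInd, mul_ite, mul_zero,
      Finset.sum_ite_eq', Finset.mem_univ, if_true]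
    rw [real_inner_comm, mul_right_comm, mul_inv_cancel₀ hN, one_mul, sub_self]
  | zero => exact inner_zero_right _
  | add g g' _ _ h h' => rw [inner_add_right, h, h', add_zero]
  | smul c g _ h => rw [real_inner_smul_right, h, mul_zero]

theorem finrank_V (n : ℕ) : Module.finrank ℝ (V N lam n) = N ^ n := by
  have hN : ((N : ℝ) ^ n)⁻¹ ≠ 0 :=
    inv_ne_zero (pow_ne_zero _ (by have := one_lt_alphabet (N := N); positivity))
  have h : LinearIndependent ℝ fun w : Fin n → Fin N => (cylInd w : L2 N lam) := by
    refine linearIndependent_of_ne_zero_of_inner_eq_zero (𝕜 := ℝ) (fun w hw => hN ?_)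
      fun w w' hww' => ?_
    · have := inner_cylInd_cylInd (lam := lam) w w
      rwa [hw, inner_zero_left, if_pos rfl, eq_comm] at this
    · change ⟪cylInd w, cylInd w'⟫_ℝ = 0
      rw [inner_cylInd_cylInd, if_neg hww']
  exact (finrank_span_eq_card h).trans (by simp)

/-- The class of the function `x ↦ c (x_1 ⋯ x_n)`. -/
noncomputable def stepFunction {n : ℕ} (c : (Fin n → Fin N) → ℝ) : L2 N lam := ∑ w, c w • cylInd w

theorem stepFunction_mem_V {n : ℕ} (c : (Fin n → Fin N) → ℝ) : stepFunction c ∈ V N lam n :=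
  Submodule.sum_mem _ fun w _ => Submodule.smul_mem _ _ (cylInd_mem_V w)

theorem stepFunction_coeFn {n : ℕ} (c : (Fin n → Fin N) → ℝ) :
    (stepFunction c : L2 N lam) =ᵐ[bernoulliMeasure N lam] fun x => c (initialWord n x) := by
  have h1 := Lp.coeFn_finsetSum (Finset.univ) fun w => c w • (cylInd w : L2 N lam)
  have h2 : ∀ᵐ x ∂bernoulliMeasure N lam, ∀ w : Fin n → Fin N,
      (c w • (cylInd w : L2 N lam) : L2 N lam) x = c w * (cyl w).indicator (fun _ => 1) x := by
    refine ae_all_iff.2 fun w => ?_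
    filter_upwards [Lp.coeFn_smul (c w) (cylInd w : L2 N lam), cylInd_coeFn (lam := lam) w]
      with x h h'
    rw [h, Pi.smul_apply, h', smul_eq_mul]
  filter_upwards [h1, h2] with x h h'
  rw [stepFunction, h]
  simp only [Finset.sum_apply, h']
  rw [Finset.sum_eq_single (initialWord n x)]
  · rw [Set.indicator_of_mem (mem_cyl_iff.2 rfl), mul_one]
  · intro w _ hw
    rw [Set.indicator_of_notMem (fun h => hw (mem_cyl_iff.1 h).symm), mul_zero]
  · simp

theorem cylInd_eq_stepFunction {m n : ℕ} (hmn : m ≤ n) (w : Fin m → Fin N) :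
    (cylInd w : L2 N lam) =
      stepFunction fun v : Fin n → Fin N => if (fun k => v (Fin.castLE hmn k)) = w then 1 else 0 := by
  refine Lp.ext ?_
  filter_upwards [cylInd_coeFn (lam := lam) w, stepFunction_coeFn (lam := lam)
    fun v : Fin n → Fin N => if (fun k => v (Fin.castLE hmn k)) = w then (1 : ℝ) else 0] with x h h'
  rw [h, h']
  by_cases hx : initialWord m x = w
  · rw [Set.indicator_of_mem (mem_cyl_iff.2 hx)]
    exact (if_pos hx).symm
  · rw [Set.indicator_of_notMem (fun h => hx (mem_cyl_iff.1 h))]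
    exact (if_neg hx).symm

theorem V_mono : Monotone (V N lam) := by
  intro m n hmn
  refine Submodule.span_le.2 ?_
  rintro _ ⟨w, rfl⟩
  change cylInd w ∈ V N lam n
  rw [cylInd_eq_stepFunction hmn]
  exact stepFunction_mem_V _

/-- A function that varies by at most `ε` on cylinders is `ε`-close to `V_n`. -/
theorem norm_sub_P_le {f : L2 N lam} {φ : FullShift N lam → ℝ}
    (hf : f =ᵐ[bernoulliMeasure N lam] φ) {n : ℕ} {ε : ℝ}
    (h : ∀ x y, initialWord n x = initialWord n y → |φ x - φ y| ≤ ε) :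
    ‖f - P N lam n f‖ ≤ ε := by
  have : NeZero N := ⟨alphabet_pos.ne'⟩
  -- Padding a word by the letter `0` selects one sample point in each cylinder, from which the
  -- approximating step function is built.
  let ext (w : Fin n → Fin N) : FullShift N lam := fun k => if h : k < n then w ⟨k, h⟩ else 0
  have hext (x : FullShift N lam) : initialWord n x = initialWord n (ext (initialWord n x)) := by
    funext k
    simp [ext, initialWord]
  have hε : 0 ≤ ε := (abs_nonneg _).trans (h (fun _ => 0) (fun _ => 0) rfl)
  set s : L2 N lam := stepFunction fun w : Fin n → Fin N => φ (ext w)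
  have h1 : ‖f - s‖ ≤ ε := by
    have := Lp.norm_le_of_ae_bound (f := f - s) hε (by
      filter_upwards [Lp.coeFn_sub f s, hf, stepFunction_coeFn fun w : Fin n → Fin N => φ (ext w)]
        with x hx hx' hx''
      rw [hx, Pi.sub_apply, hx', hx'', Real.norm_eq_abs]
      exact h _ _ (hext x))
    simpa [measureUnivNNReal] using this
  refine le_trans ?_ h1
  -- The projection is the closest point of `V_n`, hence at least as close as the step function `s`.
  rw [P, Submodule.starProjection_minimal]
  exact ciInf_le ⟨0, Set.forall_mem_range.mpr fun _ => norm_nonneg _⟩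
    (⟨s, stepFunction_mem_V _⟩ : V N lam n)

/-! ### The spectral family of the shift -/

theorem P_mem (n : ℕ) (f : L2 N lam) : P N lam n f ∈ V N lam n :=
  Submodule.starProjection_apply_mem _ _

theorem P_of_mem {n : ℕ} {f : L2 N lam} (hf : f ∈ V N lam n) : P N lam n f = f :=
  Submodule.starProjection_eq_self_iff.2 hf

theorem P_isStarProjection (n : ℕ) : IsStarProjection (P N lam n) :=
  isStarProjection_starProjection

theorem P_P_of_le {m n : ℕ} (h : m ≤ n) (f : L2 N lam) : P N lam n (P N lam m f) = P N lam m f :=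
  P_of_mem (V_mono h (P_mem m f))

theorem P_P_of_ge {m n : ℕ} (h : n ≤ m) (f : L2 N lam) : P N lam n (P N lam m f) = P N lam n f := by
  refine ext_inner_right ℝ fun g => ?_
  have hs (k : ℕ) (f g : L2 N lam) : ⟪P N lam k f, g⟫_ℝ = ⟪f, P N lam k g⟫_ℝ :=
    (P_isStarProjection k).isSelfAdjoint.isSymmetric f g
  rw [hs, hs, hs, P_P_of_le h]

theorem Q_isStarProjection (n : ℕ) : IsStarProjection (Q N lam n) :=
  (P_isStarProjection n).sub_of_mul_eq_left (P_isStarProjection (n + 1))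
    (ContinuousLinearMap.ext fun f => P_P_of_ge n.le_succ f)

theorem range_Q (n : ℕ) : (Q N lam n).range = (V N lam n)ᗮ ⊓ V N lam (n + 1) := by
  ext f
  constructor
  · rintro ⟨g, rfl⟩
    change P N lam (n + 1) g - P N lam n g ∈ _
    refine ⟨?_, Submodule.sub_mem _ (P_mem _ _) (V_mono n.le_succ (P_mem _ _))⟩
    have := Submodule.sub_starProjection_mem_orthogonal (K := V N lam n) (P N lam (n + 1) g)
    change P N lam (n + 1) g - P N lam n (P N lam (n + 1) g) ∈ _ at this
    rwa [P_P_of_ge n.le_succ] at this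
  · rintro ⟨h1, h2⟩
    refine ⟨f, ?_⟩
    change P N lam (n + 1) f - P N lam n f = f
    have h3 : P N lam n f = 0 := (Submodule.starProjection_apply_eq_zero_iff _).2 h1
    rw [P_of_mem h2, h3, sub_zero]

theorem finrank_range_Q (n : ℕ) :
    Module.finrank ℝ (Q N lam n).range = N ^ n * (N - 1) := by
  have h := Submodule.finrank_add_inf_finrank_orthogonal (V_mono (N := N) (lam := lam) n.le_succ)
  rw [range_Q]
  rw [Nat.succ_eq_add_one, finrank_V, finrank_V] at h
  rw [Nat.mul_sub, mul_one, ← pow_succ]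
  omega

variable (N lam) in
/-- The spectral projections `P_0, Q_0, Q_1, …`. -/
noncomputable def spectralProj : ℕ → L2 N lam →L[ℝ] L2 N lam
  | 0 => P N lam 0
  | n + 1 => Q N lam n

/-- Because of the index shift, component `n` lies in `V_n`, so `P_j` keeps exactly the components
with `n ≤ j`. -/
theorem spectralProj_P (n j : ℕ) (f : L2 N lam) :
    spectralProj N lam n (P N lam j f) = if n ≤ j then spectralProj N lam n f else 0 := by
  cases n with
  | zero => rw [if_pos j.zero_le]; exact P_P_of_ge j.zero_le f
  | succ n =>
    change P N lam (n + 1) (P N lam j f) - P N lam n (P N lam j f) = _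
    split_ifs with h
    · rw [P_P_of_ge h, P_P_of_ge (n.le_succ.trans h)]; rfl
    · rw [P_P_of_le (by omega), P_P_of_le (by omega), sub_self]

theorem sum_range_spectralProj (m : ℕ) (f : L2 N lam) :
    ∑ n ∈ Finset.range (m + 1), spectralProj N lam n f = P N lam m f := by
  induction m with
  | zero => simp [spectralProj]
  | succ m ih =>
    rw [Finset.sum_range_succ, ih]
    change P N lam m f + (P N lam (m + 1) f - P N lam m f) = _
    abel

theorem spectralProj_orthogonal {m n : ℕ} (h : m ≠ n) (f : L2 N lam) :
    spectralProj N lam m (spectralProj N lam n f) = 0 := by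
  cases n with
  | zero =>
    change spectralProj N lam m (P N lam 0 f) = 0
    rw [spectralProj_P, if_neg (by omega)]
  | succ n =>
    change spectralProj N lam m (P N lam (n + 1) f - P N lam n f) = 0
    rw [map_sub, spectralProj_P, spectralProj_P]
    split_ifs
    · exact sub_self _
    · omega
    · omega
    · exact sub_self _

theorem spectralProj_isStarProjection (n : ℕ) : IsStarProjection (spectralProj N lam n) := by
  cases n with
  | zero => exact P_isStarProjection 0
  | succ n => exact Q_isStarProjection n

theorem finiteDimensional_range_spectralProj (n : ℕ) :
    FiniteDimensional ℝ (spectralProj N lam n).range := by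
  cases n with
  | zero =>
    change FiniteDimensional ℝ (V N lam 0).starProjection.range
    rw [Submodule.range_starProjection]
    infer_instance
  | succ n =>
    change FiniteDimensional ℝ (Q N lam n).range
    rw [range_Q]
    exact Submodule.finiteDimensional_of_le inf_le_right

/-! ### Completeness of the spectral family -/

section Density

variable [hlam : Fact (1 < lam)]

/-- Continuous functions are dense in `L²`, and on the compact shift they are uniformly continuous,
hence nearly constant on long cylinders. -/
theorem tendsto_P (f : L2 N lam) : Tendsto (fun n => P N lam n f) atTop (𝓝 f) := by
  refine Submodule.starProjection_tendsto_self (V N lam) V_mono f ?_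
  have hd := ContinuousMap.toLp_denseRange ℝ (bernoulliMeasure N lam) ℝ
    (p := 2) (by norm_num)
  rintro g -
  refine closure_minimal ?_ (Submodule.isClosed_topologicalClosure _) (hd g)
  rintro _ ⟨φ, rfl⟩
  refine Metric.mem_closure_iff.2 fun ε hε => ?_
  obtain ⟨δ, hδ, hφ⟩ := Metric.uniformContinuous_iff.1
    (CompactSpace.uniformContinuous_of_continuous φ.continuous) (ε / 2) (by positivity)
  obtain ⟨n, hn⟩ := ((tendsto_inv_pow (lam := lam)).eventually_lt_const hδ).exists
  refine ⟨P N lam n (ContinuousMap.toLp 2 (bernoulliMeasure N lam) ℝ φ),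
    Submodule.mem_iSup_of_mem n (P_mem _ _), ?_⟩
  rw [dist_eq_norm]
  refine lt_of_le_of_lt (norm_sub_P_le (ContinuousMap.coeFn_toLp _ φ) fun x y hxy => ?_)
    (half_lt_self hε)
  exact (hφ ((dist_le_of_initialWord_eq hxy).trans_lt hn)).le

theorem isSpectralFamily : IsSpectralFamily (spectralProj N lam) :=
  .of_tendsto_sum_range spectralProj_isStarProjection (fun _ _ h f => spectralProj_orthogonal h f)
    fun f => (tendsto_add_atTop_iff_nat 1).1 (by
      simpa only [sum_range_spectralProj] using tendsto_P f)

end Density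

end L2

end FullShift

/-! ### Truncations of the energy form -/

namespace FullShift

set_option linter.unusedSectionVars false

variable {N : ℕ} {lam : ℝ}

section Truncation

variable [N.AtLeastTwo]

variable (N lam) in
/-- The pairs of points in a common cylinder of length `n`. -/
def samePrefix (n : ℕ) : Set (FullShift N lam × FullShift N lam) :=
  {p | initialWord n p.1 = initialWord n p.2}

theorem mem_samePrefix {n : ℕ} {p : FullShift N lam × FullShift N lam} :
    p ∈ samePrefix N lam n ↔ initialWord n p.1 = initialWord n p.2 := Iff.rfl

/-- The product of the increments of two functions. -/
noncomputable def incr (f g : L2 N lam) (p : FullShift N lam × FullShift N lam) : ℝ :=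
  (f p.1 - f p.2) * (g p.1 - g p.2)

theorem integrable_mul (f g : L2 N lam) :
    Integrable (fun x => f x * g x) (bernoulliMeasure N lam) :=
  (Lp.memLp f).integrable_mul (Lp.memLp g)

theorem integrable_coeFn (f : L2 N lam) : Integrable f (bernoulliMeasure N lam) :=
  (Lp.memLp f).integrable one_le_two

theorem integral_mul_eq_inner (f g : L2 N lam) :
    ∫ x, f x * g x ∂bernoulliMeasure N lam = ⟪f, g⟫_ℝ := by
  rw [L2.inner_def]
  refine integral_congr_ae (Eventually.of_forall fun x => ?_)
  exact mul_comm _ _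

theorem sum_setIntegral_cyl {n : ℕ} {φ : FullShift N lam → ℝ}
    (hφ : Integrable φ (bernoulliMeasure N lam)) :
    ∑ w : Fin n → Fin N, ∫ x in cyl w, φ x ∂bernoulliMeasure N lam =
      ∫ x, φ x ∂bernoulliMeasure N lam := by
  have h (w : Fin n → Fin N) : MeasurableSet (cyl w : Set (FullShift N lam)) := measurableSet_cyl w
  simp only [← integral_indicator (h _)]
  rw [← integral_finsetSum _ fun w _ => hφ.indicator (h w)]
  congr 1
  ext x
  rw [Finset.sum_eq_single (initialWord n x)]
  · exact Set.indicator_of_mem (mem_cyl_iff.2 rfl) _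
  · intro w _ hw
    exact Set.indicator_of_notMem (fun h => hw (mem_cyl_iff.1 h).symm) _
  · simp

/-- The cross terms in the expansion of the energy over common cylinders; they are the source of
`P_n` in the form. -/
theorem sum_setIntegral_mul_setIntegral {n : ℕ} (f g : L2 N lam) :
    ∑ w : Fin n → Fin N, (∫ x in cyl w, f x ∂bernoulliMeasure N lam) *
      ∫ x in cyl w, g x ∂bernoulliMeasure N lam = ((N : ℝ) ^ n)⁻¹ * ⟪P N lam n f, g⟫_ℝ := by
  have hN : (N : ℝ) ^ n ≠ 0 := pow_ne_zero _ (by have := one_lt_alphabet (N := N); positivity)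
  rw [P_apply, sum_inner, Finset.mul_sum]
  refine Finset.sum_congr rfl fun w _ => ?_
  rw [real_inner_smul_left, inner_cylInd, inner_cylInd]
  field_simp

theorem hasIntegral_incr_cyl {n : ℕ} (w : Fin n → Fin N) (f g : L2 N lam) :
    Integrable ((cyl w ×ˢ cyl w).indicator (incr f g))
      ((bernoulliMeasure N lam).prod (bernoulliMeasure N lam)) ∧
    ∫ p, (cyl w ×ˢ cyl w).indicator (incr f g) p
        ∂(bernoulliMeasure N lam).prod (bernoulliMeasure N lam) =
      2 * (((N : ℝ) ^ n)⁻¹ * ∫ x in cyl w, f x * g x ∂bernoulliMeasure N lam) -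
      2 * ((∫ x in cyl w, f x ∂bernoulliMeasure N lam) *
        ∫ x in cyl w, g x ∂bernoulliMeasure N lam) := by
  have hm : MeasurableSet (cyl w : Set (FullShift N lam)) := measurableSet_cyl w
  have h1 : Integrable ((cyl w).indicator fun _ => (1 : ℝ)) (bernoulliMeasure N lam) :=
    (integrable_const 1).indicator hm
  have hf := (integrable_coeFn f).indicator hm
  have hg := (integrable_coeFn g).indicator hm
  have hfg := (integrable_mul f g).indicator hm
  have i1 := hfg.mul_prod h1
  have i2 := hf.mul_prod hg
  have i3 := hg.mul_prod hf
  have i4 := h1.mul_prod hfg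
  -- Multiplying out the increments leaves products of a function of `p.1` and a function of `p.2`,
  -- to which Fubini applies termwise.
  have e : (cyl w ×ˢ cyl w).indicator (incr f g) = fun p =>
      (((cyl w).indicator (fun x => f x * g x) p.1 * (cyl w).indicator (fun _ => (1 : ℝ)) p.2 -
        (cyl w).indicator f p.1 * (cyl w).indicator g p.2) -
        (cyl w).indicator g p.1 * (cyl w).indicator f p.2) +
        (cyl w).indicator (fun _ => (1 : ℝ)) p.1 * (cyl w).indicator (fun x => f x * g x) p.2 := by
    ext p
    by_cases hp1 : p.1 ∈ cyl w
    · by_cases hp2 : p.2 ∈ cyl w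
      · rw [Set.indicator_of_mem (Set.mk_mem_prod hp1 hp2)]
        simp only [Set.indicator_of_mem hp1, Set.indicator_of_mem hp2, incr]
        ring
      · rw [Set.indicator_of_notMem (fun h => hp2 h.2)]
        simp only [Set.indicator_of_notMem hp2]
        ring
    · rw [Set.indicator_of_notMem (fun h => hp1 h.1)]
      simp only [Set.indicator_of_notMem hp1]
      ring
  rw [e]
  refine ⟨((i1.sub i2).sub i3).add i4, ?_⟩
  refine (integral_add ((i1.sub i2).sub i3) i4).trans ?_
  rw [integral_sub' (i1.sub i2) i3, integral_sub' i1 i2]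
  simp only [integral_prod_mul, integral_indicator hm, setIntegral_const, measureReal_cyl,
    smul_eq_mul, mul_one]
  ring

theorem indicator_samePrefix (n : ℕ) (φ : FullShift N lam × FullShift N lam → ℝ) :
    (samePrefix N lam n).indicator φ =
      fun p => ∑ w : Fin n → Fin N, (cyl w ×ˢ cyl w).indicator φ p := by
  ext p
  by_cases hp : initialWord n p.1 = initialWord n p.2
  · rw [Set.indicator_of_mem (mem_samePrefix.2 hp), Finset.sum_eq_single (initialWord n p.1)]
    · rw [Set.indicator_of_mem (Set.mk_mem_prod (mem_cyl_iff.2 rfl) (mem_cyl_iff.2 hp.symm))]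
    · intro w _ hw
      exact Set.indicator_of_notMem (fun h => hw (mem_cyl_iff.1 h.1).symm) _
    · simp
  · rw [Set.indicator_of_notMem (mt mem_samePrefix.1 hp)]
    refine (Finset.sum_eq_zero fun w _ => Set.indicator_of_notMem (fun h => hp ?_) _).symm
    exact (mem_cyl_iff.1 h.1).trans (mem_cyl_iff.1 h.2).symm

/-- The energy of the pairs of points in a common cylinder of length `n`. -/
theorem hasIntegral_incr_samePrefix (n : ℕ) (f g : L2 N lam) :
    Integrable ((samePrefix N lam n).indicator (incr f g))
      ((bernoulliMeasure N lam).prod (bernoulliMeasure N lam)) ∧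
    ∫ p, (samePrefix N lam n).indicator (incr f g) p
        ∂(bernoulliMeasure N lam).prod (bernoulliMeasure N lam) =
      2 * ((N : ℝ) ^ n)⁻¹ * (⟪f, g⟫_ℝ - ⟪P N lam n f, g⟫_ℝ) := by
  rw [indicator_samePrefix]
  refine ⟨integrable_finsetSum _ fun w _ => (hasIntegral_incr_cyl w f g).1, ?_⟩
  rw [integral_finsetSum _ fun w _ => (hasIntegral_incr_cyl w f g).1]
  simp only [fun w : Fin n → Fin N => (hasIntegral_incr_cyl w f g).2]
  rw [Finset.sum_sub_distrib, ← Finset.mul_sum, ← Finset.mul_sum, ← Finset.mul_sum,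
    sum_setIntegral_cyl (integrable_mul f g), sum_setIntegral_mul_setIntegral,
    integral_mul_eq_inner]
  ring

variable (N lam) in
/-- The bounded operator of the form restricted to pairs of points that differ among their first
`m` letters. -/
noncomputable def truncLaplacian (m : ℕ) : L2 N lam →L[ℝ] L2 N lam :=
  ∑ j ∈ Finset.range m, ((1 - 1 / (N : ℝ)) • ContinuousLinearMap.id ℝ (L2 N lam) - P N lam j +
    (1 / (N : ℝ)) • P N lam (j + 1))

variable (N) in
/-- The eigenvalues of the Laplacian, in the order of `spectralProj`. -/
noncomputable def laplacianEigenvalue : ℕ → ℝ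
  | 0 => 0
  | n + 1 => shiftEigenvalue N n

variable (N) in
/-- The eigenvalues of `truncLaplacian`. -/
noncomputable def truncEigenvalue (m : ℕ) : ℕ → ℝ
  | 0 => 0
  | n + 1 => if n < m then shiftEigenvalue N n else (1 - 1 / (N : ℝ)) * m

/-- On `Im Q_n` the summand with index `j` acts as `1 - 1/N`, `1` or `0` according to `j < n`, `j =
n` or `j > n`. On `Im P_0` it is `1 - 1/N - 1 + 1/N = 0`. -/
theorem spectralProj_truncLaplacian (m n : ℕ) (f : L2 N lam) :
    spectralProj N lam n (truncLaplacian N lam m f) =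
      truncEigenvalue N m n • spectralProj N lam n f := by
  induction m with
  | zero => cases n <;> simp [truncLaplacian, truncEigenvalue]
  | succ m ih =>
    have h : truncLaplacian N lam (m + 1) f = truncLaplacian N lam m f +
        ((1 - 1 / (N : ℝ)) • f - P N lam m f + (1 / (N : ℝ)) • P N lam (m + 1) f) := by
      simp [truncLaplacian, Finset.sum_range_succ]
    rw [h, map_add, ih, map_add, map_sub, map_smul, map_smul, spectralProj_P, spectralProj_P]
    set v := spectralProj N lam n f
    cases n with
    | zero =>
      simp only [truncEigenvalue, Nat.zero_le, if_true]
      module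
    | succ n =>
      rcases lt_trichotomy n m with h | rfl | h
      · simp only [truncEigenvalue, if_pos h, if_pos (h.trans m.lt_succ_self),
          if_pos (Nat.succ_le_of_lt h), if_pos ((Nat.succ_le_of_lt h).trans m.le_succ)]
        module
      · simp only [truncEigenvalue, lt_irrefl, if_false, Nat.lt_succ_self, if_true, le_refl,
          Nat.not_succ_le_self, shiftEigenvalue]
        module
      · simp only [truncEigenvalue, if_neg h.not_gt, if_neg (show ¬ n < m + 1 by omega),
          if_neg (show ¬ n + 1 ≤ m by omega), if_neg (show ¬ n + 1 ≤ m + 1 by omega)]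
        push_cast
        module

theorem truncEigenvalue_nonneg (m n : ℕ) : 0 ≤ truncEigenvalue N m n := by
  have h1 := one_lt_alphabet (N := N)
  have h : 0 ≤ 1 - 1 / (N : ℝ) := by
    rw [sub_nonneg, div_le_one (by positivity)]; exact h1.le
  cases n with
  | zero => exact le_rfl
  | succ n => simp only [truncEigenvalue, shiftEigenvalue]; split_ifs <;> positivity

theorem truncEigenvalue_le (m n : ℕ) : truncEigenvalue N m n ≤ laplacianEigenvalue N n := by
  have h1 := one_lt_alphabet (N := N)
  have h : 0 ≤ 1 - 1 / (N : ℝ) := by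
    rw [sub_nonneg, div_le_one (by positivity)]; exact h1.le
  cases n with
  | zero => exact le_rfl
  | succ n =>
    simp only [truncEigenvalue, laplacianEigenvalue, shiftEigenvalue]
    split_ifs with hnm
    · exact le_rfl
    · have h2 : (m : ℝ) ≤ n := by exact_mod_cast not_lt.1 hnm
      have h3 := mul_le_mul_of_nonneg_left h2 h
      linarith

theorem truncEigenvalue_of_le {m n : ℕ} (h : n ≤ m) :
    truncEigenvalue N m n = laplacianEigenvalue N n := by
  cases n with
  | zero => rfl
  | succ n => exact if_pos h

theorem laplacianEigenvalue_nonneg (n : ℕ) : 0 ≤ laplacianEigenvalue N n :=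
  (truncEigenvalue_nonneg n n).trans (truncEigenvalue_le n n)

end Truncation

/-! ### Passage from truncated energies to the form -/

section Energy

variable [N.AtLeastTwo] [hlam : Fact (1 < lam)]

variable (N lam) in
/-- The dimension of the full shift. -/
noncomputable abbrev shiftDim : ℝ := Real.log N / Real.log lam

/-- The exponent is chosen so that `lam ^ δ = N`: the power of the distance is then the measure of
the smallest cylinder containing both points. -/
theorem dist_rpow_shiftDim {x y : FullShift N lam} (hxy : x ≠ y) :
    dist x y ^ shiftDim N lam = ((N : ℝ) ^ PiNat.firstDiff (E := fun _ => Fin N) x y)⁻¹ := by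
  have h0 : 0 < lam := one_pos.trans hlam.out
  have hN : (0 : ℝ) < N := one_pos.trans one_lt_alphabet
  have hd : dist x y = (lam ^ PiNat.firstDiff (E := fun _ => Fin N) x y)⁻¹ := if_neg hxy
  have hlog : lam ^ shiftDim N lam = N := by
    rw [Real.rpow_def_of_pos h0, mul_div_cancel₀ _ (Real.log_pos hlam.out).ne', Real.exp_log hN]
  rw [hd, Real.inv_rpow (by positivity), ← Real.rpow_natCast, ← Real.rpow_mul h0.le, mul_comm,
    Real.rpow_mul h0.le, hlog, Real.rpow_natCast]

variable (N lam) in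
/-- The pairs of points that differ among the first `m` letters, and the diagonal. -/
def truncSet (m : ℕ) : Set (FullShift N lam × FullShift N lam) :=
  {p | p.1 = p.2 ∨ initialWord m p.1 ≠ initialWord m p.2}

theorem measurableSet_truncSet (m : ℕ) : MeasurableSet (truncSet N lam m) :=
  measurableSet_diagonal.union (measurableSet_initialWord_eq m).compl

/-- Putting the diagonal into every set makes them cover the whole product, with no need to know
that the diagonal is null; the energy density vanishes there. -/
theorem aecover_truncSet :
    AECover ((bernoulliMeasure N lam).prod (bernoulliMeasure N lam)) atTop (truncSet N lam) where
  ae_eventually_mem := Eventually.of_forall fun p => by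
    by_cases hp : p.1 = p.2
    · exact Eventually.of_forall fun m => Or.inl hp
    · filter_upwards [eventually_gt_atTop (PiNat.firstDiff (E := fun _ => Fin N) p.1 p.2)] with m hm
      exact Or.inr fun h => hm.not_ge ((initialWord_eq_iff_le_firstDiff hp).1 h)
  measurableSet := measurableSet_truncSet

/-- The integrand of the energy form. -/
noncomputable def energyDensity (f g : L2 N lam) (p : FullShift N lam × FullShift N lam) : ℝ :=
  incr f g p / dist p.1 p.2 ^ shiftDim N lam

/-- The difference of the two indicators singles out the pairs whose first difference is at position
`j`, where the kernel is `N ^ j`. This rewrites a singular integrand through the computable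
integrals over `samePrefix`. -/
theorem indicator_truncSet_energyDensity (m : ℕ) (f g : L2 N lam) :
    (truncSet N lam m).indicator (energyDensity f g) = fun p => ∑ j ∈ Finset.range m,
      (N : ℝ) ^ j * ((samePrefix N lam j).indicator (incr f g) p -
        (samePrefix N lam (j + 1)).indicator (incr f g) p) := by
  ext p
  by_cases hp : p.1 = p.2
  · have h0 : incr f g p = 0 := by simp [incr, hp]
    have h1 (s : Set (FullShift N lam × FullShift N lam)) : s.indicator (incr f g) p = 0 := Set.indicator_apply_eq_zero.2 fun _ => h0
    have h2 : (truncSet N lam m).indicator (energyDensity f g) p = 0 :=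
      Set.indicator_apply_eq_zero.2 fun _ => by rw [energyDensity, h0, zero_div]
    simp only [h1, h2, sub_zero, mul_zero, Finset.sum_const_zero]
  set k := PiNat.firstDiff (E := fun _ => Fin N) p.1 p.2
  have hterm (j : ℕ) : (samePrefix N lam j).indicator (incr f g) p =
      if j ≤ k then incr f g p else 0 := by
    split_ifs with h
    · exact Set.indicator_of_mem (mem_samePrefix.2 ((initialWord_eq_iff_le_firstDiff hp).2 h)) _
    · exact Set.indicator_of_notMem
        (fun h' => h ((initialWord_eq_iff_le_firstDiff hp).1 (mem_samePrefix.1 h'))) _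
  simp only [hterm]
  have hj (j : ℕ) : (N : ℝ) ^ j * ((if j ≤ k then incr f g p else 0) -
      if j + 1 ≤ k then incr f g p else 0) = if j = k then (N : ℝ) ^ k * incr f g p else 0 := by
    split_ifs with h1 h2 h3 h3
    · omega
    · ring
    · rw [h3]; ring
    · omega
    · omega
    · omega
    · omega
    · ring
  simp only [hj, Finset.sum_ite_eq', Finset.mem_range]
  split_ifs with hk
  · rw [Set.indicator_of_mem, energyDensity, dist_rpow_shiftDim hp, div_inv_eq_mul, mul_comm]
    exact Or.inr fun h => hk.not_ge ((initialWord_eq_iff_le_firstDiff hp).1 h)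
  · refine Set.indicator_of_notMem (fun h => ?_) _
    exact h.elim hp fun h => h ((initialWord_eq_iff_le_firstDiff hp).2 (not_lt.1 hk))

theorem hasIntegral_truncSet (m : ℕ) (f g : L2 N lam) :
    IntegrableOn (energyDensity f g) (truncSet N lam m)
      ((bernoulliMeasure N lam).prod (bernoulliMeasure N lam)) ∧
    ∫ p in truncSet N lam m, energyDensity f g p
      ∂(bernoulliMeasure N lam).prod (bernoulliMeasure N lam) =
      2 * ⟪truncLaplacian N lam m f, g⟫_ℝ := by
  have hN : (N : ℝ) ≠ 0 := (one_pos.trans one_lt_alphabet).ne'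
  have hi (j : ℕ) (_ : j ∈ Finset.range m) : Integrable (fun p => (N : ℝ) ^ j *
      ((samePrefix N lam j).indicator (incr f g) p -
        (samePrefix N lam (j + 1)).indicator (incr f g) p))
      ((bernoulliMeasure N lam).prod (bernoulliMeasure N lam)) :=
    ((hasIntegral_incr_samePrefix j f g).1.sub
      (hasIntegral_incr_samePrefix (j + 1) f g).1).const_mul ((N : ℝ) ^ j)
  rw [← integrable_indicator_iff (measurableSet_truncSet m),
    ← integral_indicator (measurableSet_truncSet m), indicator_truncSet_energyDensity]
  refine ⟨integrable_finsetSum _ hi, ?_⟩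
  rw [integral_finsetSum _ hi, truncLaplacian, _root_.sum_apply, sum_inner,
    Finset.mul_sum]
  refine Finset.sum_congr rfl fun j _ => ?_
  rw [integral_const_mul, integral_sub (hasIntegral_incr_samePrefix j f g).1
    (hasIntegral_incr_samePrefix (j + 1) f g).1, (hasIntegral_incr_samePrefix j f g).2, (hasIntegral_incr_samePrefix (j + 1) f g).2]
  simp only [add_apply, sub_apply, smul_apply, ContinuousLinearMap.id_apply, inner_add_left,
    inner_sub_left, real_inner_smul_left]
  have hN' : (N : ℝ) ^ j ≠ 0 := pow_ne_zero _ hN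
  rw [pow_succ]
  field_simp
  ring

theorem mem_logFormDomain_iff {f : L2 N lam} :
    f ∈ logFormDomain (bernoulliMeasure N lam) (shiftDim N lam) ↔
      Integrable (energyDensity f f) ((bernoulliMeasure N lam).prod (bernoulliMeasure N lam)) := by
  have : (energyDensity f f) = fun p : FullShift N lam × FullShift N lam =>
      (f p.1 - f p.2) ^ 2 / dist p.1 p.2 ^ shiftDim N lam := by
    ext p; rw [energyDensity, incr, sq]
  rw [this]
  rfl

/-- The integrand is nonnegative, so a bound on the truncated energies that is uniform in `m`
survives the limit. -/
theorem mem_logFormDomain_of_bounded {f : L2 N lam} {C : ℝ}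
    (h : ∀ m, ⟪truncLaplacian N lam m f, f⟫_ℝ ≤ C) :
    f ∈ logFormDomain (bernoulliMeasure N lam) (shiftDim N lam) := by
  refine mem_logFormDomain_iff.2 (aecover_truncSet.integrable_of_integral_bounded_of_nonneg_ae
    (2 * C) (fun m => (hasIntegral_truncSet m f f).1) (Eventually.of_forall fun p => ?_)
    (Eventually.of_forall fun m => ?_))
  · exact div_nonneg (mul_self_nonneg _) (Real.rpow_nonneg dist_nonneg _)
  · rw [(hasIntegral_truncSet m f f).2]
    linarith [h m]

theorem tendsto_logForm (f g : logFormDomain (bernoulliMeasure N lam) (shiftDim N lam)) :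
    Tendsto (fun m => ⟪truncLaplacian N lam m (f : L2 N lam), (g : L2 N lam)⟫_ℝ) atTop
      (𝓝 (logForm (bernoulliMeasure N lam) (shiftDim N lam) f g)) := by
  have hi : Integrable (energyDensity (f : L2 N lam) g)
      ((bernoulliMeasure N lam).prod (bernoulliMeasure N lam)) :=
    logForm_integrable_mul _ _ _ _ f.2 g.2
  have := (aecover_truncSet.integral_tendsto_of_countably_generated hi).const_mul (1 / 2)
  refine this.congr fun m => ?_
  rw [(hasIntegral_truncSet m _ _).2]
  ring

/-! ### The graph of the Laplacian -/

/-- Relative to `h`, the operator `truncLaplacian m` acts by the ratios of truncated to final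
eigenvalues. They lie in `[0, 1]` and are eventually `1`, so dominated convergence applies. -/
theorem tendsto_truncLaplacian {f h : L2 N lam}
    (hh : ∀ n, spectralProj N lam n h = laplacianEigenvalue N n • spectralProj N lam n f) :
    Tendsto (fun m => truncLaplacian N lam m f) atTop (𝓝 h) := by
  refine isSpectralFamily.tendsto_of_multiplier (f := h) (C := 1) (m₀ := fun _ => 1)
    (m := fun m n => if laplacianEigenvalue N n = 0 then 1 else
      truncEigenvalue N m n / laplacianEigenvalue N n)
    (Eventually.of_forall fun m n => ?_) (fun n => (one_smul ℝ _).symm)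
    (Eventually.of_forall fun m n => ?_) fun n => ?_
  · rw [spectralProj_truncLaplacian, hh, smul_smul]
    split_ifs with h0
    · have := truncEigenvalue_le (N := N) m n
      have := truncEigenvalue_nonneg (N := N) m n
      rw [h0, mul_zero, le_antisymm (by linarith) this]
    · rw [div_mul_cancel₀ _ h0]
  · split_ifs with h0
    · simp
    · have hpos := lt_of_le_of_ne (laplacianEigenvalue_nonneg (N := N) n) (Ne.symm h0)
      have h1 := (div_le_one hpos).2 (truncEigenvalue_le (N := N) m n)
      have h2 := div_nonneg (truncEigenvalue_nonneg (N := N) m n) hpos.le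
      rw [abs_le]
      constructor <;> linarith
  · refine tendsto_const_nhds.congr' ?_
    filter_upwards [eventually_ge_atTop n] with m hm
    rw [truncEigenvalue_of_le hm]
    split_ifs with h0
    · rfl
    · rw [div_self h0]

theorem truncLaplacian_isSymmetric (m : ℕ) (f g : L2 N lam) :
    ⟪truncLaplacian N lam m f, g⟫_ℝ = ⟪f, truncLaplacian N lam m g⟫_ℝ :=
  isSpectralFamily.multiplier_isSymmetric (spectralProj_truncLaplacian m) f g

/-- The condition that `(f, h)` lies in the graph of multiplication by the eigenvalues implies that
it lies in the graph associated to the form. -/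
theorem mem_formGraph_of_spectralProj {f h : L2 N lam}
    (hh : ∀ n, spectralProj N lam n h = laplacianEigenvalue N n • spectralProj N lam n f) :
    (f, h) ∈ formGraph (logFormDomain (bernoulliMeasure N lam) (shiftDim N lam))
      (logForm (bernoulliMeasure N lam) (shiftDim N lam)) := by
  have hlim := tendsto_truncLaplacian hh
  -- A convergent sequence is bounded, so the truncated energies of `f` are bounded and `f` belongs
  -- to the form domain.
  obtain ⟨C, hC⟩ := (hlim.inner (𝕜 := ℝ) (tendsto_const_nhds (x := f))).bddAbove_range
  have hf := mem_logFormDomain_of_bounded fun m => hC ⟨m, rfl⟩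
  refine ⟨hf, fun g => tendsto_nhds_unique (tendsto_logForm ⟨f, hf⟩ g) ?_⟩
  exact hlim.inner tendsto_const_nhds

theorem spectralProj_smul_spectralProj (m n : ℕ) (f : L2 N lam) :
    spectralProj N lam m (laplacianEigenvalue N n • spectralProj N lam n f) =
      laplacianEigenvalue N m • spectralProj N lam m (spectralProj N lam n f) := by
  rw [map_smul]
  rcases eq_or_ne m n with rfl | h
  · rfl
  · rw [spectralProj_orthogonal h, smul_zero, smul_zero]

/-- For the forward direction, `f` is tested against the eigenvector `R_n k`: symmetry of the
truncations moves the operator onto `R_n k`, where it converges to multiplication by the eigenvalue.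
-/
theorem mem_formGraph_iff {f h : L2 N lam} :
    (f, h) ∈ formGraph (logFormDomain (bernoulliMeasure N lam) (shiftDim N lam))
      (logForm (bernoulliMeasure N lam) (shiftDim N lam)) ↔
    ∀ n, spectralProj N lam n h = laplacianEigenvalue N n • spectralProj N lam n f := by
  refine ⟨fun ⟨hf, hform⟩ n => ext_inner_right ℝ fun k => ?_, mem_formGraph_of_spectralProj⟩
  have hk : ∀ m, spectralProj N lam m (laplacianEigenvalue N n • spectralProj N lam n k) =
      laplacianEigenvalue N m • spectralProj N lam m (spectralProj N lam n k) := fun m =>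
    spectralProj_smul_spectralProj m n k
  obtain ⟨hkD, -⟩ := mem_formGraph_of_spectralProj hk
  have h1 := tendsto_logForm ⟨f, hf⟩ ⟨_, hkD⟩
  rw [hform] at h1
  have h2 : Tendsto (fun m => ⟪truncLaplacian N lam m f, spectralProj N lam n k⟫_ℝ) atTop
      (𝓝 ⟪f, laplacianEigenvalue N n • spectralProj N lam n k⟫_ℝ) := by
    simp only [truncLaplacian_isSymmetric]
    exact tendsto_const_nhds.inner (tendsto_truncLaplacian hk)
  have h3 := tendsto_nhds_unique h1 h2
  rw [isSpectralFamily.inner_left, real_inner_smul_left, isSpectralFamily.inner_left,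
    ← real_inner_smul_right]
  exact h3

theorem mem_graph_Laplacian_iff (f h : L2 N lam) :
    (f, h) ∈ (Laplacian N lam).graph ↔
      ∀ n, spectralProj N lam n h = laplacianEigenvalue N n • spectralProj N lam n f := by
  rw [Laplacian, logDirichletLaplacian, formOperator, Submodule.toLinearPMap_graph_eq]
  · exact mem_formGraph_iff
  · rintro ⟨f, h⟩ hp (rfl : f = 0)
    refine isSpectralFamily.ext fun n => ?_
    rw [mem_formGraph_iff.1 hp n, map_zero, smul_zero]

end Energy

end FullShift

/-! ### Lipschitz functions and the heat semigroup on the full shift -/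

namespace FullShift

set_option linter.unusedSectionVars false

variable {N : ℕ} {lam : ℝ} [N.AtLeastTwo]

theorem one_sub_inv_alphabet_pos : 0 < 1 - 1 / (N : ℝ) := by
  have h := one_lt_alphabet (N := N)
  rw [sub_pos, div_lt_one (by positivity)]
  exact h

theorem tendsto_laplacianEigenvalue : Tendsto (laplacianEigenvalue N) atTop atTop := by
  refine (tendsto_add_atTop_iff_nat 1).1 ?_
  exact tendsto_atTop_add_const_left _ _
    (tendsto_natCast_atTop_atTop.const_mul_atTop one_sub_inv_alphabet_pos)

theorem summable_heat_trace_iff (t : ℝ) :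
    (Summable fun n => Real.exp (-(t * laplacianEigenvalue N n)) *
      Module.finrank ℝ (spectralProj N lam n).range) ↔
    (N : ℝ) * Real.log N / ((N : ℝ) - 1) < t := by
  have hN := one_lt_alphabet (N := N)
  have hN0 : (0 : ℝ) < N := one_pos.trans hN
  have hN1 : (N : ℝ) - 1 ≠ 0 := (sub_pos.2 hN).ne'
  -- Dropping the component of `P_0` leaves the eigenvalues of the `Q_n`, and the series becomes
  -- geometric.
  rw [← summable_nat_add_iff 1]
  have h (n : ℕ) : Real.exp (-(t * laplacianEigenvalue N (n + 1))) *
      Module.finrank ℝ (spectralProj N lam (n + 1)).range =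
      (Real.exp (-t) * ((N : ℝ) - 1)) * (N * Real.exp (-(t * (1 - 1 / (N : ℝ))))) ^ n := by
    have hr : Module.finrank ℝ (spectralProj N lam (n + 1)).range = N ^ n * (N - 1) :=
      finrank_range_Q n
    have he : Real.exp (-(t * laplacianEigenvalue N (n + 1))) =
        Real.exp (-t) * Real.exp (-(t * (1 - 1 / (N : ℝ)))) ^ n := by
      rw [← Real.exp_nat_mul, ← Real.exp_add]
      congr 1
      simp only [laplacianEigenvalue, shiftEigenvalue]
      ring
    rw [hr, he, mul_pow, Nat.cast_mul, Nat.cast_pow, Nat.cast_sub alphabet_pos, Nat.cast_one]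
    ring
  simp only [h]
  rw [summable_mul_left_iff (mul_ne_zero (Real.exp_pos _).ne' hN1),
    summable_geometric_iff_norm_lt_one, Real.norm_of_nonneg (by positivity),
    ← Real.log_lt_log_iff (by positivity) one_pos, Real.log_mul hN0.ne' (Real.exp_pos _).ne',
    Real.log_exp, Real.log_one, div_lt_iff₀ (sub_pos.2 hN)]
  have e : t * ((N : ℝ) - 1) = N * (t * (1 - 1 / (N : ℝ))) := by field_simp
  rw [e, mul_lt_mul_iff_right₀ hN0, ← sub_eq_add_neg, sub_neg]

variable [hlam : Fact (1 < lam)]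

/-- Points closer than `lam ^ (-n)` share a cylinder of length `n`, where the indicator is constant;
for other pairs its increment is at most `1 ≤ lam ^ n * dist x y`. -/
theorem V_le_lipschitzL2 (n : ℕ) : V N lam n ≤ lipschitzL2 (bernoulliMeasure N lam) := by
  have h0 : 0 < lam := one_pos.trans hlam.out
  refine Submodule.span_le.2 ?_
  rintro _ ⟨w, rfl⟩
  refine ⟨(cyl w).indicator fun _ => 1, (lam ^ n).toNNReal,
    LipschitzWith.of_dist_le_mul fun x y => ?_, cylInd_coeFn w⟩
  rw [Real.coe_toNNReal _ (by positivity), Real.dist_eq]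
  rcases lt_or_ge (dist x y) (lam ^ n)⁻¹ with h | h
  · have hxy : initialWord n x = initialWord n y :=
      initialWord_eq_iff.2 (mem_cylinder_of_shiftDist_lt hlam.out x y n h)
    have hi : (cyl w).indicator (fun _ => (1 : ℝ)) x = (cyl w).indicator (fun _ => 1) y := by
      have hmem : x ∈ cyl w ↔ y ∈ cyl w := by rw [mem_cyl_iff, mem_cyl_iff, hxy]
      by_cases hx : x ∈ cyl w
      · rw [Set.indicator_of_mem hx, Set.indicator_of_mem (hmem.1 hx)]
      · rw [Set.indicator_of_notMem hx, Set.indicator_of_notMem (mt hmem.2 hx)]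
    rw [hi, sub_self, abs_zero]
    positivity
  · have h1 : 1 ≤ lam ^ n * dist x y := by
      rwa [inv_le_iff_one_le_mul₀' (by positivity)] at h
    refine le_trans ?_ h1
    have hb (z : FullShift N lam) : 0 ≤ (cyl w).indicator (fun _ => (1 : ℝ)) z ∧
        (cyl w).indicator (fun _ => (1 : ℝ)) z ≤ 1 :=
      ⟨Set.indicator_nonneg (fun _ _ => zero_le_one) z,
        Set.indicator_le_self' (fun _ _ => zero_le_one) z⟩
    have hx := hb x
    have hy := hb y
    rw [abs_le]
    constructor <;> linarith

theorem summable_shiftEigenvalue_mul_pow :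
    Summable fun n : ℕ => shiftEigenvalue N n ^ 2 * ((lam ^ n)⁻¹) ^ 2 := by
  have hr : ‖(lam⁻¹ ^ 2 : ℝ)‖ < 1 := by
    have h1 := inv_lt_one_of_one_lt₀ hlam.out
    have h2 : 0 ≤ lam⁻¹ := inv_nonneg.2 (one_pos.trans hlam.out).le
    rw [norm_pow, Real.norm_of_nonneg h2]
    exact pow_lt_one₀ h2 h1 two_ne_zero
  have h0 := summable_pow_mul_geometric_of_norm_lt_one 0 hr
  have h1 := (summable_pow_mul_geometric_of_norm_lt_one 1 hr).mul_left (2 * (1 - 1 / (N : ℝ)))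
  have h2 := (summable_pow_mul_geometric_of_norm_lt_one 2 hr).mul_left ((1 - 1 / (N : ℝ)) ^ 2)
  refine ((h0.add h1).add h2).congr fun n => ?_
  rw [shiftEigenvalue, ← inv_pow, ← pow_mul, ← pow_mul, mul_comm n 2]
  ring

theorem mem_domain_Laplacian_iff (f : L2 N lam) :
    f ∈ (Laplacian N lam).domain ↔
      Summable fun n => shiftEigenvalue N n ^ 2 * ‖Q N lam n f‖ ^ 2 := by
  rw [LinearPMap.mem_domain_iff]
  simp only [mem_graph_Laplacian_iff]
  have h : (Summable fun n => shiftEigenvalue N n ^ 2 * ‖Q N lam n f‖ ^ 2) ↔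
      Summable fun n => laplacianEigenvalue N n ^ 2 * ‖spectralProj N lam n f‖ ^ 2 :=
    summable_nat_add_iff (f := fun n => laplacianEigenvalue N n ^ 2 * ‖spectralProj N lam n f‖ ^ 2) 1
  rw [h]
  exact ⟨fun ⟨_, hh⟩ => isSpectralFamily.summable_sq_of_smul hh,
    fun hs => isSpectralFamily.exists_smul_of_summable hs⟩

theorem norm_Q_le_norm_sub_P (n : ℕ) (f : L2 N lam) : ‖Q N lam n f‖ ≤ ‖f - P N lam n f‖ := by
  have h : Q N lam n f = P N lam (n + 1) (f - P N lam n f) := by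
    rw [map_sub, P_P_of_le n.le_succ]; rfl
  rw [h]
  exact Submodule.norm_starProjection_apply_le _ _

/-- A `K`-Lipschitz function varies by at most `K lam ^ (-n)` on cylinders of length `n`, so its
spectral components decay geometrically. -/
theorem lipschitzL2_le_domain :
    lipschitzL2 (bernoulliMeasure N lam) ≤ (Laplacian N lam).domain := by
  rintro f ⟨g, K, hg, hfg⟩
  refine (mem_domain_Laplacian_iff f).2 ((summable_shiftEigenvalue_mul_pow (N := N)
    (lam := lam)).mul_left ((K : ℝ) ^ 2) |>.of_nonneg_of_le (fun n => by positivity) fun n => ?_)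
  have h1 : ‖f - P N lam n f‖ ≤ K * (lam ^ n)⁻¹ := norm_sub_P_le hfg fun x y hxy => by
    rw [← Real.dist_eq]
    exact (hg.dist_le_mul x y).trans
      (mul_le_mul_of_nonneg_left (dist_le_of_initialWord_eq hxy) K.2)
  have h2 := pow_le_pow_left₀ (norm_nonneg _) ((norm_Q_le_norm_sub_P n f).trans h1) 2
  calc shiftEigenvalue N n ^ 2 * ‖Q N lam n f‖ ^ 2
      ≤ shiftEigenvalue N n ^ 2 * (K * (lam ^ n)⁻¹) ^ 2 := by gcongr
    _ = (K : ℝ) ^ 2 * (shiftEigenvalue N n ^ 2 * ((lam ^ n)⁻¹) ^ 2) := by ring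

theorem spectralProj_mem_lipschitzL2 (n : ℕ) (f : L2 N lam) :
    spectralProj N lam n f ∈ lipschitzL2 (bernoulliMeasure N lam) := by
  cases n with
  | zero => exact V_le_lipschitzL2 0 (P_mem 0 f)
  | succ n =>
    exact Submodule.sub_mem _ (V_le_lipschitzL2 _ (P_mem _ f)) (V_le_lipschitzL2 _ (P_mem _ f))

theorem hasSum_Q (f : L2 N lam) : HasSum (fun n => Q N lam n f) (f - P N lam 0 f) := by
  have h := (hasSum_nat_add_iff' 1).2 ((isSpectralFamily (N := N) (lam := lam)).hasSum f)
  rwa [Finset.sum_range_one] at h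

theorem spectralProj_mem_graph (n : ℕ) (f : L2 N lam) :
    (spectralProj N lam n f, laplacianEigenvalue N n • spectralProj N lam n f) ∈
      (Laplacian N lam).graph :=
  (mem_graph_Laplacian_iff _ _).2 fun m => spectralProj_smul_spectralProj m n f

theorem hasSum_Laplacian (f : (Laplacian N lam).domain) :
    HasSum (fun n => shiftEigenvalue N n • Q N lam n (f : L2 N lam)) (Laplacian N lam f) := by
  have hg := (mem_graph_Laplacian_iff _ _).1 ((Laplacian N lam).mem_graph f)
  have h := (hasSum_nat_add_iff' 1).2 (isSpectralFamily.hasSum_smul hg)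
  rwa [Finset.sum_range_one, laplacianEigenvalue, zero_smul, sub_zero] at h

theorem exists_heat_multiplier (t : ℝ≥0) : ∃ T : L2 N lam →L[ℝ] L2 N lam, ∀ n f,
    spectralProj N lam n (T f) =
      Real.exp (-(t * laplacianEigenvalue N n)) • spectralProj N lam n f := by
  refine isSpectralFamily.exists_multiplier _ 1 fun n => ?_
  rw [abs_of_pos (Real.exp_pos _), Real.exp_le_one_iff, neg_nonpos]
  exact mul_nonneg t.2 (laplacianEigenvalue_nonneg n)

theorem tendsto_heat_eigenvalue {t : ℝ} (ht : 0 < t) :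
    Tendsto (fun n => Real.exp (-(t * laplacianEigenvalue N n))) atTop (𝓝 0) :=
  Real.tendsto_exp_neg_atTop_nhds_zero.comp (tendsto_laplacianEigenvalue.const_mul_atTop ht)

end FullShift

theorem proposition5p6 (N : ℕ) [N.AtLeastTwo] (lam : ℝ) [Fact (1 < lam)] :
    -- the `Q_n` are mutually orthogonal projections of rank `N^n (N - 1)` and `P_0 + ∑ Q_n = 1`
    (∀ n, IsStarProjection (FullShift.Q N lam n) ∧
      Module.finrank ℝ (FullShift.Q N lam n).range = N ^ n * (N - 1)) ∧
    (∀ m n, m ≠ n → FullShift.Q N lam m ∘L FullShift.Q N lam n = 0) ∧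
    (∀ f, HasSum (fun n => FullShift.Q N lam n f) (f - FullShift.P N lam 0 f)) ∧
    -- the Laplacian vanishes on `Im P_0` and is multiplication by the eigenvalue on `Im Q_n`
    (∀ f, (FullShift.P N lam 0 f, 0) ∈ (FullShift.Laplacian N lam).graph) ∧
    (∀ n f, (FullShift.Q N lam n f, shiftEigenvalue N n • FullShift.Q N lam n f) ∈
      (FullShift.Laplacian N lam).graph) ∧
    -- its domain, and its action there
    (∀ f, f ∈ (FullShift.Laplacian N lam).domain ↔
      Summable fun n => shiftEigenvalue N n ^ 2 * ‖FullShift.Q N lam n f‖ ^ 2) ∧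
    (∀ f : (FullShift.Laplacian N lam).domain,
      HasSum (fun n => shiftEigenvalue N n • FullShift.Q N lam n f)
        (FullShift.Laplacian N lam f)) ∧
    -- the Lipschitz functions are a core
    (FullShift.Laplacian N lam).HasCore (lipschitzL2 (FullShift.bernoulliMeasure N lam)) ∧
    -- the semigroup `T t = e^{-t Δ}` exists, is unique and compact, and the trace class threshold
    ∃ T : ℝ≥0 → Lp ℝ 2 (FullShift.bernoulliMeasure N lam) →L[ℝ] Lp ℝ 2 (FullShift.bernoulliMeasure N lam),
      IsHeatSemigroup (FullShift.Laplacian N lam) T ∧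
      (∀ T', IsHeatSemigroup (FullShift.Laplacian N lam) T' → T' = T) ∧
      ∀ t : ℝ≥0, 0 < t → IsCompactOperator (T t) ∧
        (IsTraceClass (T t) ↔ (N : ℝ) * Real.log N / ((N : ℝ) - 1) < t) := by 
  obtain ⟨T, hT⟩ := Classical.axiom_of_choice
    (fun t => FullShift.exists_heat_multiplier (N := N) (lam := lam) t)
  have hR := FullShift.isSpectralFamily (N := N) (lam := lam)
  have hheat := hR.isHeatSemigroup FullShift.laplacianEigenvalue_nonneg
    FullShift.mem_graph_Laplacian_iff hT
  refine ⟨fun n => ⟨FullShift.Q_isStarProjection n, FullShift.finrank_range_Q n⟩,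
    fun m n hmn => ContinuousLinearMap.ext fun f =>
      -- `Q_n` is the component of index `n + 1`, index `0` being taken by `P_0`.
      FullShift.spectralProj_orthogonal (m := m + 1) (n := n + 1) (by omega) f,
    FullShift.hasSum_Q, fun f => ?_, fun n f => FullShift.spectralProj_mem_graph (n + 1) f,
    FullShift.mem_domain_Laplacian_iff, FullShift.hasSum_Laplacian,
    hR.hasCore FullShift.mem_graph_Laplacian_iff FullShift.lipschitzL2_le_domain
      FullShift.spectralProj_mem_lipschitzL2,
    T, hheat, fun T' hT' => hR.isHeatSemigroup_unique FullShift.mem_graph_Laplacian_iff hheat hT',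
    fun t ht => ⟨hR.isCompactOperator_of_tendsto_zero
      FullShift.finiteDimensional_range_spectralProj (FullShift.tendsto_heat_eigenvalue ht) (hT t),
      (hR.isTraceClass_iff FullShift.finiteDimensional_range_spectralProj
        (fun n => Real.exp_pos _) (hT t)).trans (FullShift.summable_heat_trace_iff t)⟩⟩
  have h := FullShift.spectralProj_mem_graph 0 f
  rwa [FullShift.laplacianEigenvalue, zero_smul] at h
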